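/- Let $k$ be a commutative ring (for instance $k=\mathbb C$); all algebras are associative unital $k$-algebras, all modules are $k$-modules, and all maps are $k$-linear. We use Sweedler notation. **Bialgebroids.** A *left $R$-bialgebroid* $(\mathcal K,\mathfrak s,\mathfrak t,\Delta,\varepsilon)$ consists of algebras $R,\mathcal K$, an algebra map $\mathfrak s:R\to\mathcal K$ and an anti-algebra map $\mathfrak t:R\to\mathcal K$ with commuting ranges, and an $R$-coring structure $\Delta:\mathcal K\to\mathcal K\otimes_R\mathcal K$, $\varepsilon:\mathcal K\to R$ on $\mathcal K$ with bimodule structure $r\kappa r'=\mathfrak s(r)\mathfrak t(r')\kappa$, such that $\kappa^{(1)}\mathfrak t(r)\otimes_R\kappa^{(2)}=\kappa^{(1)}\otimes_R\kappa^{(2)}\mathfrak s(r)$, $\Delta$ is unital and multiplicative, $\varepsilon(1)=1$ and $\varepsilon(\kappa\kappa')=\varepsilon(\kappa\,\mathfrak s(\varepsilon(\kappa')))$. It is a *left $\times_R$-Hopf algebra* if $\nu:\mathcal K\otimes_{R^{op}}\mathcal K\to\mathcal K\otimes_R\mathcal K$, $\kappa\otimes\kappa'\mapsto\kappa^{(1)}\otimes\kappa^{(2)}\kappa'$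 is bijective, where $\kappa\mathfrak t(r)\otimes\kappa'=\kappa\otimes\mathfrak t(r)\kappa'$ in the domain; write $\kappa^-\otimes\kappa^+=\nu^{-1}(\kappa\otimes_R1)$. A *right $R$-bialgebroid* $(\mathcal B,\mathfrak s,\mathfrak t,\Delta,\varepsilon)$ is defined likewise with the bimodule structure $rbr'=b\,\mathfrak s(r')\mathfrak t(r)$ and the conditions $b^{(1)}\otimes_R\mathfrak t(r)b^{(2)}=\mathfrak s(r)b^{(1)}\otimes_R b^{(2)}$, $\Delta$ unital and multiplicative, $\varepsilon(1)=1$, $\varepsilon(bb')=\varepsilon(\mathfrak s(\varepsilon(b))b')$. It is a *right $\times_R$-Hopf algebra* if $\nu:\mathcal B\otimes_{R^{op}}\mathcal B\to\mathcal B\otimes_R\mathcal B$, $b\otimes b'\mapsto bb'^{(1)}\otimes b'^{(2)}$ is bijective, where $b\mathfrak t(r)\otimes b'=b\otimes\mathfrak t(r)b'$ in the domain; write $b^-\otimes b^+=\nu^{-1}(1\otimes_R b)$. **SAYD modules.** A *right-left SAYD module* over a left $\times_R$-Hopf algebra $\mathcal K$ is a right $\mathcal K$-module and left comodule $M$ over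 the coring $\mathcal K$ (a left $R$-module with a left $R$-linear, coassociative, counital coaction $m\mapsto m_{\langle-1\rangle}\otimes_R m_{\langle0\rangle}\in\mathcal K\otimes_R M$) such that $rm=m\triangleleft\mathfrak t(r)$, $\varepsilon(m_{\langle-1\rangle}\mathfrak s(r))m_{\langle0\rangle}=m\triangleleft\mathfrak s(r)$, $$(m\triangleleft\kappa)_{\langle-1\rangle}\otimes_R(m\triangleleft\kappa)_{\langle0\rangle}={\kappa^{(2)}}^+m_{\langle-1\rangle}\kappa^{(1)}\otimes_R m_{\langle0\rangle}\triangleleft{\kappa^{(2)}}^-,\qquad m_{\langle0\rangle}\triangleleft m_{\langle-1\rangle}=m.$$ A *left-right SAYD module* over a right $\times_R$-Hopf algebra $\mathcal B$ is a left $\mathcal B$-module and right comodule $M$ over the coring $\mathcal B$ (a right $R$-module with a right $R$-linear, coassociative, counital coaction $m\mapsto m_{\langle0\rangle}\otimes_R m_{\langle1\rangle}\in M\otimes_R\mathcal B$) such that $mr=\mathfrak t(r)\triangleright m$, $m_{\langle0\rangle}\varepsilon(\mathfrak s(r)m_{\langle1\rangle})=\mathfrak s(r)\triangleright m$, $$(b\triangleright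 m)_{\langle0\rangle}\otimes_R(b\triangleright m)_{\langle1\rangle}={b^{(1)}}^+\triangleright m_{\langle0\rangle}\otimes_R b^{(2)}m_{\langle1\rangle}{b^{(1)}}^-,\qquad m_{\langle1\rangle}\triangleright m_{\langle0\rangle}=m.$$ Morphisms of SAYD modules are the linear and colinear maps; this gives categories ${}^{\mathcal K}SAYD_{\mathcal K}$ and ${}_{\mathcal B}SAYD^{\mathcal B}$. **Equivariant Galois extensions.** Let $\mathcal B$ be a right $\times_R$-Hopf algebra and $T$ a *right $\mathcal B$-comodule algebra*: an algebra, $R$-bimodule and right $\mathcal B$-comodule with $(\tau r)\tau'=\tau(r\tau')$ and with unital, multiplicative coaction $\tau\mapsto\tau_{\langle0\rangle}\otimes_R\tau_{\langle1\rangle}$. Let $S=\{q\in T:\ q_{\langle0\rangle}\otimes_R q_{\langle1\rangle}=q\otimes_R1\}$, let $\mathcal K$ be a left $\times_S$-Hopf algebra and let $T$ be a *left $\mathcal K$-module algebra*: a left $\mathcal K$-module with $\kappa\triangleright1=\mathfrak s(\varepsilon(\kappa))\triangleright1$, $\kappa\triangleright(\tau\tau')=(\kappa^{(1)}\triangleright\tau)(\kappa^{(2)}\triangleright\tau')$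 and $(\mathfrak t(q)\triangleright\tau)\tau'=\tau(\mathfrak s(q)\triangleright\tau')$ for $q\in S$; its $S$-ring structure is assumed to be the inclusion $S\subseteq T$, i.e. $\mathfrak s(q)\triangleright1=q$ for $q\in S$. Assume that $T$ is a $\mathcal K$-equivariant $\mathcal B$-Galois extension of $S$: the map $can:T\otimes_ST\to T\otimes_R\mathcal B$, $\tau'\otimes_S\tau\mapsto\tau'\tau_{\langle0\rangle}\otimes_R\tau_{\langle1\rangle}$ is bijective and $(\kappa\triangleright\tau)_{\langle0\rangle}\otimes_R(\kappa\triangleright\tau)_{\langle1\rangle}=\kappa\triangleright\tau_{\langle0\rangle}\otimes_R\tau_{\langle1\rangle}$. Write $b_{\langle-\rangle}\otimes_Sb_{\langle+\rangle}=can^{-1}(1\otimes_Rb)$. **Proposition 3.4.** For every right-left SAYD module $M$ over $\mathcal K$, the formulas $$b\triangleright(m\otimes_{\mathcal K}\tau)=m_{\langle0\rangle}\otimes_{\mathcal K}b_{\langle+\rangle}\bigl(m_{\langle-1\rangle}\triangleright(\tau b_{\langle-\rangle})\bigr),\qquad (m\otimes_{\mathcal K}\tau)r=m\otimes_{\mathcal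 K}\tau r,$$ $$m\otimes_{\mathcal K}\tau\mapsto(m\otimes_{\mathcal K}\tau_{\langle0\rangle})\otimes_R\tau_{\langle1\rangle}$$ are well defined and make $M\otimes_{\mathcal K}T$ a left-right SAYD module over $\mathcal B$. For every morphism $\varphi:M\to N$ of right-left SAYD modules over $\mathcal K$, the map $\varphi\otimes_{\mathcal K}\mathrm{Id}_T$ is a morphism $M\otimes_{\mathcal K}T\to N\otimes_{\mathcal K}T$ of left-right SAYD modules over $\mathcal B$. The assignment $M\mapsto M\otimes_{\mathcal K}T$, $\varphi\mapsto\varphi\otimes_{\mathcal K}\mathrm{Id}_T$ is a covariant functor ${}^{\mathcal K}SAYD_{\mathcal K}\to{}_{\mathcal B}SAYD^{\mathcal B}$. -/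

import Mathlib

open CategoryTheory MulOpposite
open scoped TensorProduct

universe uk uR uB uK uT uM w

noncomputable section

/-! ### Balanced tensor products

Mathlib's tensor product needs a commutative base. Everything below is a module over a commutative
ring `k`, and the tensor product over a noncommutative algebra `R` is the usual quotient of the
tensor product over `k`. The right action of `r` on `M` is the operator `a r`, its left action on
`N` is the operator `b r`, so that the several module structures carried by one object
stay visible. -/

section Balanced

variable {k : Type*} [CommRing k] {R : Type*} {R' : Type*}
  {M N P : Type*} [AddCommGroup M] [Module k M] [AddCommGroup N] [Module k N]
  [AddCommGroup P] [Module k P]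

/-- The relations `(m r) ⊗ n = m ⊗ (r n)`. -/
def Bal.rel (a : R → Module.End k M) (b : R → Module.End k N) : Submodule k (M ⊗[k] N) :=
  Submodule.span k {z | ∃ r m n, z = (a r m) ⊗ₜ[k] n - m ⊗ₜ[k] (b r n)}

/-- The balanced tensor product `M ⊗_R N`, where `r` acts on the right of `M` by `a r` and on the
left of `N` by `b r`. -/
def Bal (a : R → Module.End k M) (b : R → Module.End k N) : Type _ :=
  (M ⊗[k] N) ⧸ Bal.rel a b

namespace Bal

variable (a : R → Module.End k M) (b : R → Module.End k N)

instance : AddCommGroup (Bal a b) := inferInstanceAs (AddCommGroup ((M ⊗[k] N) ⧸ Bal.rel a b))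

instance : Module k (Bal a b) := inferInstanceAs (Module k ((M ⊗[k] N) ⧸ Bal.rel a b))

/-- The canonical bilinear map `M → N → M ⊗_R N`. -/
def mk : M →ₗ[k] N →ₗ[k] Bal a b :=
  (TensorProduct.mk k M N).compr₂ (Submodule.mkQ (Bal.rel a b))

/-- The elementary tensor `m ⊗_R n`. -/
def tmul (m : M) (n : N) : Bal a b := mk a b m n

theorem tmul_balanced (r : R) (m : M) (n : N) : tmul a b (a r m) n = tmul a b m (b r n) := by
  refine (Submodule.Quotient.eq (Bal.rel a b)).2 ?_
  exact Submodule.subset_span ⟨r, m, n, rfl⟩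

/-- The universal property: a balanced bilinear map factors through `M ⊗_R N`. -/
def lift (f : M →ₗ[k] N →ₗ[k] P) (h : ∀ r m n, f (a r m) n = f m (b r n)) : Bal a b →ₗ[k] P :=
  Submodule.liftQ (Bal.rel a b) (TensorProduct.lift f) (by
    unfold Bal.rel
    refine Submodule.span_le.2 ?_
    rintro _ ⟨r, m, n, rfl⟩
    simp [h])

theorem lift_tmul (f : M →ₗ[k] N →ₗ[k] P) (h : ∀ r m n, f (a r m) n = f m (b r n)) (m : M)
    (n : N) : lift a b f h (tmul a b m n) = f m n := by
  exact (Submodule.liftQ_apply _ _ _).trans (TensorProduct.lift.tmul _ _)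

variable {a b}

/-- `z.Rep x y` says that `z = ∑ i, x i ⊗ y i`. An identity in Sweedler notation, such as
`Δ(k) = k⁽¹⁾ ⊗ k⁽²⁾` followed by an expression in `k⁽¹⁾`, `k⁽²⁾`, is stated below for all
representatives `x`, `y`. -/
def Rep (z : Bal a b) {n : ℕ} (x : Fin n → M) (y : Fin n → N) : Prop :=
  z = ∑ i, tmul a b (x i) (y i)

theorem exists_rep (z : Bal a b) : ∃ (n : ℕ) (x : Fin n → M) (y : Fin n → N), z.Rep x y := by
  obtain ⟨u, rfl⟩ := Submodule.Quotient.mk_surjective (Bal.rel a b) z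
  induction u using TensorProduct.induction_on with
  | zero => exact ⟨0, fun _ => 0, fun _ => 0, by simp [Rep]; rfl⟩
  | tmul m n => exact ⟨1, fun _ => m, fun _ => n, by simp [Rep]; rfl⟩
  | add u v hu hv =>
    obtain ⟨n, x, y, h⟩ := hu
    obtain ⟨n', x', y', h'⟩ := hv
    refine ⟨n + n', Fin.append x x', Fin.append y y', ?_⟩
    simp only [Rep, Fin.sum_univ_add, Fin.append_left, Fin.append_right] at *
    rw [← h, ← h']
    rfl

end Bal

/-- The relations of `M ⊗_R N ⊗_R' P`. -/
def Bal₃.rel (a : R → Module.End k M) (b : R → Module.End k N) (c : R' → Module.End k N)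
    (d : R' → Module.End k P) : Submodule k (M ⊗[k] (N ⊗[k] P)) :=
  Submodule.span k
    ({z | ∃ r m n p, z = (a r m) ⊗ₜ[k] (n ⊗ₜ[k] p) - m ⊗ₜ[k] ((b r n) ⊗ₜ[k] p)} ∪
      {z | ∃ r m n p, z = m ⊗ₜ[k] ((c r n) ⊗ₜ[k] p) - m ⊗ₜ[k] (n ⊗ₜ[k] (d r p))})

/-- The threefold balanced tensor product `M ⊗_R N ⊗_R' P`: over `R`, `r` acts by `a r` on the right
of `M` and by `b r` on the left of `N`; over `R'`, by `c r` on the right of `N` and by `d r` on the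
left of `P`. -/
def Bal₃ (a : R → Module.End k M) (b : R → Module.End k N) (c : R' → Module.End k N)
    (d : R' → Module.End k P) : Type _ :=
  (M ⊗[k] (N ⊗[k] P)) ⧸ Bal₃.rel a b c d

namespace Bal₃

variable (a : R → Module.End k M) (b : R → Module.End k N) (c : R' → Module.End k N)
  (d : R' → Module.End k P)

instance : AddCommGroup (Bal₃ a b c d) :=
  inferInstanceAs (AddCommGroup ((M ⊗[k] (N ⊗[k] P)) ⧸ Bal₃.rel a b c d))

instance : Module k (Bal₃ a b c d) :=
  inferInstanceAs (Module k ((M ⊗[k] (N ⊗[k] P)) ⧸ Bal₃.rel a b c d))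

/-- The elementary tensor `m ⊗ n ⊗ p`. -/
def tmul (m : M) (n : N) (p : P) : Bal₃ a b c d :=
  Submodule.Quotient.mk (m ⊗ₜ[k] (n ⊗ₜ[k] p))

end Bal₃

end Balanced

/-! ### Left bialgebroids and left ×-Hopf algebras -/

section Left

variable {k : Type uk} [CommRing k] {R : Type uR} [Ring R] [Algebra k R]
  {K : Type uK} [Ring K] [Algebra k K]

/-- Left multiplication by `f r`, as a family of operators on `K`. -/
abbrev mulL (f : R → K) : R → Module.End k K := fun r => LinearMap.mulLeft k (f r)

/-- Right multiplication by `f r`, as a family of operators on `K`. -/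
abbrev mulR (f : R → K) : R → Module.End k K := fun r => LinearMap.mulRight k (f r)

variable (k R K) in
/-- A left `R`-bialgebroid `(K, s, t, Δ, ε)`. The `R`-bimodule structure of `K` is
`r k r' = s(r) t(r') k`, so in `K ⊗_R K` one has `t(r) k ⊗ k' = k ⊗ s(r) k'`. -/
structure LeftBialgebroid where
  /-- source map -/
  s : R →ₐ[k] K
  /-- target map, an anti-homomorphism on `R` -/
  t : Rᵐᵒᵖ →ₐ[k] K
  s_comm_t : ∀ r r' : R, s r * t (op r') = t (op r') * s r
  /-- coproduct -/
  comul : K →ₗ[k] Bal (k := k) (mulL fun r : R => t (op r)) (mulL fun r : R => s r)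
  /-- counit -/
  counit : K →ₗ[k] R
  -- `Δ` and `ε` are maps of `R`-bimodules
  comul_s : ∀ (r : R) (κ : K) {n : ℕ} (x y : Fin n → K), (comul κ).Rep x y →
    comul (s r * κ) = ∑ i, Bal.tmul _ _ (s r * x i) (y i)
  comul_t : ∀ (r : R) (κ : K) {n : ℕ} (x y : Fin n → K), (comul κ).Rep x y →
    comul (t (op r) * κ) = ∑ i, Bal.tmul _ _ (x i) (t (op r) * y i)
  counit_s : ∀ (r : R) (κ : K), counit (s r * κ) = r * counit κ
  counit_t : ∀ (r : R) (κ : K), counit (t (op r) * κ) = counit κ * r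
  -- `K` is an `R`-coring
  coassoc : ∀ (κ : K) {n p q : ℕ} (x y : Fin n → K) (u v : Fin n → Fin p → K)
    (u' v' : Fin n → Fin q → K), (comul κ).Rep x y →
    (∀ i, (comul (x i)).Rep (u i) (v i)) → (∀ i, (comul (y i)).Rep (u' i) (v' i)) →
    ∑ i, ∑ j, Bal₃.tmul (k := k) (mulL fun r : R => t (op r)) (mulL fun r : R => s r)
        (mulL fun r : R => t (op r)) (mulL fun r : R => s r) (u i j) (v i j) (y i) =
      ∑ i, ∑ j, Bal₃.tmul _ _ _ _ (x i) (u' i j) (v' i j)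
  counit_left : ∀ (κ : K) {n : ℕ} (x y : Fin n → K), (comul κ).Rep x y →
    ∑ i, s (counit (x i)) * y i = κ
  counit_right : ∀ (κ : K) {n : ℕ} (x y : Fin n → K), (comul κ).Rep x y →
    ∑ i, t (op (counit (y i))) * x i = κ
  -- compatibility with the multiplication
  takeuchi : ∀ (r : R) (κ : K) {n : ℕ} (x y : Fin n → K), (comul κ).Rep x y →
    ∑ i, Bal.tmul (k := k) (mulL fun r : R => t (op r)) (mulL fun r : R => s r)
        (x i * t (op r)) (y i) =
      ∑ i, Bal.tmul _ _ (x i) (y i * s r)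
  comul_one : comul 1 = Bal.tmul _ _ 1 1
  comul_mul : ∀ (κ κ' : K) {n n' : ℕ} (x y : Fin n → K) (x' y' : Fin n' → K),
    (comul κ).Rep x y → (comul κ').Rep x' y' →
    comul (κ * κ') = ∑ i, ∑ j, Bal.tmul _ _ (x i * x' j) (y i * y' j)
  counit_one : counit 1 = 1
  counit_mul : ∀ κ κ' : K, counit (κ * κ') = counit (κ * s (counit κ'))

namespace LeftBialgebroid

variable (H : LeftBialgebroid k R K)

/-- The left multiplications by `s(r)`. -/
abbrev sL : R → Module.End k K := mulL fun r : R => H.s r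

/-- The left multiplications by `t(r)`. -/
abbrev tL : R → Module.End k K := mulL fun r : R => H.t (op r)

/-- The right multiplications by `t(r)`. -/
abbrev tR : R → Module.End k K := mulR fun r : R => H.t (op r)

/-- `x ⊗ y ↦ (z ↦ x ⊗ y z)` on `K ⊗_R K`. -/
def mulSnd : Bal H.tL H.sL →ₗ[k] K →ₗ[k] Bal H.tL H.sL :=
  Bal.lift _ _ (LinearMap.mk₂ k (fun x y => (Bal.mk H.tL H.sL x).comp (LinearMap.mulLeft k y))
    (fun x x' y => by ext z; simp) (fun c x y => by ext z; simp)
    (fun x y y' => by ext z; simp [add_mul]) (fun c x y => by ext z; simp))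
    (fun r x y => by
      ext z
      simpa [mul_assoc, Bal.tmul] using Bal.tmul_balanced H.tL H.sL r x (y * z))

theorem mulSnd_tmul (x y z : K) :
    H.mulSnd (Bal.tmul _ _ x y) z = Bal.tmul _ _ x (y * z) := by
  rw [mulSnd, Bal.lift_tmul]
  rfl

theorem comul_mul_t (κ : K) (r : R) (z : K) :
    H.mulSnd (H.comul (κ * H.t (op r))) z = H.mulSnd (H.comul κ) (H.t (op r) * z) := by
  have h1 : (H.comul (1 : K)).Rep (fun _ : Fin 1 => (1 : K)) (fun _ => 1) := by
    simp [Bal.Rep, H.comul_one]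
  have h2 : (H.comul (H.t (op r))).Rep (fun _ : Fin 1 => (1 : K)) (fun _ => H.t (op r)) := by
    have := H.comul_t r 1 _ _ h1
    simpa [Bal.Rep] using this
  obtain ⟨n, x, y, h⟩ := (H.comul κ).exists_rep
  rw [H.comul_mul κ _ x y _ _ h h2, show H.comul κ = _ from h]
  simp [mulSnd_tmul, mul_assoc]

/-- The map `ν : K ⊗_{Rᵒᵖ} K → K ⊗_R K`, `κ ⊗ κ' ↦ κ⁽¹⁾ ⊗ κ⁽²⁾ κ'`; in the domain
`κ t(r) ⊗ κ' = κ ⊗ t(r) κ'`. -/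
def nu : Bal H.tR H.tL →ₗ[k] Bal H.tL H.sL :=
  Bal.lift _ _ (H.mulSnd ∘ₗ H.comul) (fun r x y => H.comul_mul_t x r y)

end LeftBialgebroid

variable (k R K) in
/-- A left `×_R`-Hopf algebra: a left `R`-bialgebroid with bijective `ν`. -/
structure LeftTimesHopf extends LeftBialgebroid k R K where
  nu_bijective : Function.Bijective toLeftBialgebroid.nu

/-- `κ ↦ κ⁻ ⊗_{Rᵒᵖ} κ⁺ = ν⁻¹(κ ⊗_R 1)`. -/
def LeftTimesHopf.trans (H : LeftTimesHopf k R K) (κ : K) : Bal H.tR H.tL :=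
  (LinearEquiv.ofBijective H.nu H.nu_bijective).symm (Bal.tmul _ _ κ 1)

/-- A left comodule over (the underlying coring of) a left bialgebroid: a left `R`-module `M` with
a left `R`-linear, coassociative, counital coaction `M → K ⊗_R M`, `m ↦ m₋₁ ⊗ m₀`. -/
structure LeftComodule (H : LeftBialgebroid k R K) (M : Type uM) [AddCommGroup M] [Module k M] where
  /-- the left `R`-module structure -/
  lact : R →ₐ[k] Module.End k M
  /-- the coaction -/
  coact : M →ₗ[k] Bal H.tL (fun r : R => lact r)
  coact_lact : ∀ (r : R) (m : M) {n : ℕ} (x : Fin n → K) (y : Fin n → M), (coact m).Rep x y →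
    coact (lact r m) = ∑ i, Bal.tmul _ _ (H.s r * x i) (y i)
  coact_coassoc : ∀ (m : M) {n p q : ℕ} (x : Fin n → K) (y : Fin n → M) (u v : Fin n → Fin p → K)
    (u' : Fin n → Fin q → K) (v' : Fin n → Fin q → M), (coact m).Rep x y →
    (∀ i, (H.comul (x i)).Rep (u i) (v i)) → (∀ i, (coact (y i)).Rep (u' i) (v' i)) →
    ∑ i, ∑ j, Bal₃.tmul H.tL H.sL H.tL (fun r : R => lact r) (u i j) (v i j) (y i) =
      ∑ i, ∑ j, Bal₃.tmul _ _ _ _ (x i) (u' i j) (v' i j)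
  coact_counit : ∀ (m : M) {n : ℕ} (x : Fin n → K) (y : Fin n → M), (coact m).Rep x y →
    ∑ i, lact (H.counit (x i)) (y i) = m

/-- The structure of a right-left stable anti Yetter-Drinfeld module over a left ×-Hopf algebra:
a right module (`act (op κ) m` is `m ◁ κ`) and left comodule with the following compatibilities. -/
structure RightLeftSAYD (H : LeftTimesHopf k R K) (M : Type uM) [AddCommGroup M] [Module k M]
    extends LeftComodule H.toLeftBialgebroid M where
  /-- the right `K`-module structure -/
  act : Kᵐᵒᵖ →ₐ[k] Module.End k M
  -- the `R`-bimodule structures coincide: `r m = m ◁ t(r)` and `ε(m₋₁ s(r)) m₀ = m ◁ s(r)`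
  lact_eq : ∀ (r : R) (m : M), lact r m = act (op (H.t (op r))) m
  ract_eq : ∀ (r : R) (m : M) {n : ℕ} (x : Fin n → K) (y : Fin n → M), (coact m).Rep x y →
    ∑ i, lact (H.counit (x i * H.s r)) (y i) = act (op (H.s r)) m
  -- `(m ◁ κ)₋₁ ⊗ (m ◁ κ)₀ = κ⁽²⁾⁺ m₋₁ κ⁽¹⁾ ⊗ m₀ ◁ κ⁽²⁾⁻`
  ayd : ∀ (κ : K) (m : M) {n p q : ℕ} (κ₁ κ₂ : Fin n → K) (κ₂m κ₂p : Fin n → Fin p → K)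
    (x : Fin q → K) (y : Fin q → M), (H.comul κ).Rep κ₁ κ₂ →
    (∀ i, (H.trans (κ₂ i)).Rep (κ₂m i) (κ₂p i)) → (coact m).Rep x y →
    coact (act (op κ) m) =
      ∑ i, ∑ j, ∑ l, Bal.tmul _ _ (κ₂p i j * x l * κ₁ i) (act (op (κ₂m i j)) (y l))
  -- stability `m₀ ◁ m₋₁ = m`
  stable : ∀ (m : M) {n : ℕ} (x : Fin n → K) (y : Fin n → M), (coact m).Rep x y →
    ∑ i, act (op (x i)) (y i) = m

/-- Right-left SAYD modules over `H`, as objects of a category. -/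
structure RightLeftSAYDCat (H : LeftTimesHopf k R K) where
  /-- the underlying `k`-module -/
  carrier : Type w
  [addCommGroup : AddCommGroup carrier]
  [module : Module k carrier]
  /-- the structure maps -/
  str : RightLeftSAYD H carrier

attribute [instance] RightLeftSAYDCat.addCommGroup RightLeftSAYDCat.module

/-- Morphisms: `K`-linear and `K`-colinear maps. -/
@[ext]
structure RightLeftSAYDCat.Hom {H : LeftTimesHopf k R K} (M N : RightLeftSAYDCat.{uk, uR, uK, w} H)
    where
  /-- the underlying linear map -/
  toLin : M.carrier →ₗ[k] N.carrier
  map_act : ∀ (κ : K) (m : M.carrier), toLin (M.str.act (op κ) m) = N.str.act (op κ) (toLin m)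
  map_coact : ∀ (m : M.carrier) {n : ℕ} (x : Fin n → K) (y : Fin n → M.carrier),
    (M.str.coact m).Rep x y → N.str.coact (toLin m) = ∑ i, Bal.tmul _ _ (x i) (toLin (y i))

instance {H : LeftTimesHopf k R K} : Category (RightLeftSAYDCat.{uk, uR, uK, w} H) where
  Hom M N := RightLeftSAYDCat.Hom M N
  id M := ⟨LinearMap.id, fun _ _ => rfl, fun _ _ _ _ h => h⟩
  comp f g := ⟨g.toLin ∘ₗ f.toLin, fun κ m => by simp [f.map_act, g.map_act],
    fun m _ x y h => by simpa using g.map_coact _ x _ (f.map_coact m x y h)⟩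

end Left

/-! ### Right bialgebroids and right ×-Hopf algebras -/

section Right

variable {k : Type uk} [CommRing k] {R : Type uR} [Ring R] [Algebra k R]
  {B : Type uB} [Ring B] [Algebra k B]

variable (k R B) in
/-- A right `R`-bialgebroid `(B, s, t, Δ, ε)`. The `R`-bimodule structure of `B` is
`r b r' = b s(r') t(r)`, so in `B ⊗_R B` one has `b s(r) ⊗ b' = b ⊗ b' t(r)`. -/
structure RightBialgebroid where
  /-- source map -/
  s : R →ₐ[k] B
  /-- target map, an anti-homomorphism on `R` -/
  t : Rᵐᵒᵖ →ₐ[k] B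
  s_comm_t : ∀ r r' : R, s r * t (op r') = t (op r') * s r
  /-- coproduct -/
  comul : B →ₗ[k] Bal (k := k) (mulR fun r : R => s r) (mulR fun r : R => t (op r))
  /-- counit -/
  counit : B →ₗ[k] R
  -- `Δ` and `ε` are maps of `R`-bimodules
  comul_s : ∀ (r : R) (b : B) {n : ℕ} (x y : Fin n → B), (comul b).Rep x y →
    comul (b * s r) = ∑ i, Bal.tmul _ _ (x i) (y i * s r)
  comul_t : ∀ (r : R) (b : B) {n : ℕ} (x y : Fin n → B), (comul b).Rep x y →
    comul (b * t (op r)) = ∑ i, Bal.tmul _ _ (x i * t (op r)) (y i)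
  counit_s : ∀ (r : R) (b : B), counit (b * s r) = counit b * r
  counit_t : ∀ (r : R) (b : B), counit (b * t (op r)) = r * counit b
  -- `B` is an `R`-coring
  coassoc : ∀ (b : B) {n p q : ℕ} (x y : Fin n → B) (u v : Fin n → Fin p → B)
    (u' v' : Fin n → Fin q → B), (comul b).Rep x y →
    (∀ i, (comul (x i)).Rep (u i) (v i)) → (∀ i, (comul (y i)).Rep (u' i) (v' i)) →
    ∑ i, ∑ j, Bal₃.tmul (k := k) (mulR fun r : R => s r) (mulR fun r : R => t (op r))
        (mulR fun r : R => s r) (mulR fun r : R => t (op r)) (u i j) (v i j) (y i) =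
      ∑ i, ∑ j, Bal₃.tmul _ _ _ _ (x i) (u' i j) (v' i j)
  counit_left : ∀ (b : B) {n : ℕ} (x y : Fin n → B), (comul b).Rep x y →
    ∑ i, y i * t (op (counit (x i))) = b
  counit_right : ∀ (b : B) {n : ℕ} (x y : Fin n → B), (comul b).Rep x y →
    ∑ i, x i * s (counit (y i)) = b
  -- compatibility with the multiplication
  takeuchi : ∀ (r : R) (b : B) {n : ℕ} (x y : Fin n → B), (comul b).Rep x y →
    ∑ i, Bal.tmul (k := k) (mulR fun r : R => s r) (mulR fun r : R => t (op r))
        (x i) (t (op r) * y i) =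
      ∑ i, Bal.tmul _ _ (s r * x i) (y i)
  comul_one : comul 1 = Bal.tmul _ _ 1 1
  comul_mul : ∀ (b b' : B) {n n' : ℕ} (x y : Fin n → B) (x' y' : Fin n' → B),
    (comul b).Rep x y → (comul b').Rep x' y' →
    comul (b * b') = ∑ i, ∑ j, Bal.tmul _ _ (x i * x' j) (y i * y' j)
  counit_one : counit 1 = 1
  counit_mul : ∀ b b' : B, counit (b * b') = counit (s (counit b) * b')

namespace RightBialgebroid

variable (H : RightBialgebroid k R B)

/-- The right multiplications by `s(r)`. -/
abbrev sR : R → Module.End k B := mulR fun r : R => H.s r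

/-- The right multiplications by `t(r)`. -/
abbrev tR : R → Module.End k B := mulR fun r : R => H.t (op r)

/-- The left multiplications by `t(r)`. -/
abbrev tL : R → Module.End k B := mulL fun r : R => H.t (op r)

/-- `x ⊗ y ↦ (z ↦ z x ⊗ y)` on `B ⊗_R B`. -/
def mulFst : Bal H.sR H.tR →ₗ[k] B →ₗ[k] Bal H.sR H.tR :=
  Bal.lift _ _ (LinearMap.mk₂ k
    (fun x y => ((Bal.mk H.sR H.tR).flip y).comp (LinearMap.mulRight k x))
    (fun x x' y => by ext z; simp [mul_add]) (fun c x y => by ext z; simp)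
    (fun x y y' => by ext z; simp) (fun c x y => by ext z; simp))
    (fun r x y => by
      ext z
      simpa [mul_assoc, Bal.tmul] using Bal.tmul_balanced H.sR H.tR r (z * x) y)

theorem mulFst_tmul (x y z : B) :
    H.mulFst (Bal.tmul _ _ x y) z = Bal.tmul _ _ (z * x) y := by
  rw [mulFst, Bal.lift_tmul]
  rfl

theorem comul_t_mul (b : B) (r : R) (z : B) :
    H.mulFst (H.comul b) (z * H.t (op r)) = H.mulFst (H.comul (H.t (op r) * b)) z := by
  have h1 : (H.comul (1 : B)).Rep (fun _ : Fin 1 => (1 : B)) (fun _ => 1) := by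
    simp [Bal.Rep, H.comul_one]
  have h2 : (H.comul (H.t (op r))).Rep (fun _ : Fin 1 => H.t (op r)) (fun _ => (1 : B)) := by
    have := H.comul_t r 1 _ _ h1
    simpa [Bal.Rep] using this
  obtain ⟨n, x, y, h⟩ := (H.comul b).exists_rep
  rw [H.comul_mul _ b _ _ x y h2 h, show H.comul b = _ from h]
  simp [mulFst_tmul, mul_assoc]

/-- The map `ν : B ⊗_{Rᵒᵖ} B → B ⊗_R B`, `b ⊗ b' ↦ b b'⁽¹⁾ ⊗ b'⁽²⁾`; in the domain
`b t(r) ⊗ b' = b ⊗ t(r) b'`. -/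
def nu : Bal H.tR H.tL →ₗ[k] Bal H.sR H.tR :=
  Bal.lift _ _ (H.mulFst ∘ₗ H.comul).flip (fun r x y => H.comul_t_mul y r x)

end RightBialgebroid

variable (k R B) in
/-- A right `×_R`-Hopf algebra: a right `R`-bialgebroid with bijective `ν`. -/
structure RightTimesHopf extends RightBialgebroid k R B where
  nu_bijective : Function.Bijective toRightBialgebroid.nu

/-- `b ↦ b⁻ ⊗_{Rᵒᵖ} b⁺ = ν⁻¹(1 ⊗_R b)`. -/
def RightTimesHopf.trans (H : RightTimesHopf k R B) (b : B) : Bal H.tR H.tL :=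
  (LinearEquiv.ofBijective H.nu H.nu_bijective).symm (Bal.tmul _ _ 1 b)

/-- A right comodule over (the underlying coring of) a right bialgebroid: a right `R`-module `M`
with a right `R`-linear, coassociative, counital coaction `M → M ⊗_R B`, `m ↦ m₀ ⊗ m₁`. -/
structure RightComodule (H : RightBialgebroid k R B) (M : Type uM) [AddCommGroup M] [Module k M]
    where
  /-- the right `R`-module structure -/
  ract : Rᵐᵒᵖ →ₐ[k] Module.End k M
  /-- the coaction -/
  coact : M →ₗ[k] Bal (fun r : R => ract (op r)) H.tR
  coact_ract : ∀ (r : R) (m : M) {n : ℕ} (x : Fin n → M) (y : Fin n → B), (coact m).Rep x y →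
    coact (ract (op r) m) = ∑ i, Bal.tmul _ _ (x i) (y i * H.s r)
  coact_coassoc : ∀ (m : M) {n p q : ℕ} (x : Fin n → M) (y : Fin n → B)
    (u : Fin n → Fin p → M) (v : Fin n → Fin p → B) (u' v' : Fin n → Fin q → B),
    (coact m).Rep x y →
    (∀ i, (coact (x i)).Rep (u i) (v i)) → (∀ i, (H.comul (y i)).Rep (u' i) (v' i)) →
    ∑ i, ∑ j, Bal₃.tmul (fun r : R => ract (op r)) H.tR H.sR H.tR (u i j) (v i j) (y i) =
      ∑ i, ∑ j, Bal₃.tmul _ _ _ _ (x i) (u' i j) (v' i j)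
  coact_counit : ∀ (m : M) {n : ℕ} (x : Fin n → M) (y : Fin n → B), (coact m).Rep x y →
    ∑ i, ract (op (H.counit (y i))) (x i) = m

/-- The structure of a left-right stable anti Yetter-Drinfeld module over a right ×-Hopf algebra:
a left module (`act b m` is `b ▷ m`) and right comodule with the following compatibilities. -/
structure LeftRightSAYD (H : RightTimesHopf k R B) (M : Type uM) [AddCommGroup M] [Module k M]
    extends RightComodule H.toRightBialgebroid M where
  /-- the left `B`-module structure -/
  act : B →ₐ[k] Module.End k M
  -- the `R`-bimodule structures coincide: `m r = t(r) ▷ m` and `m₀ ε(s(r) m₁) = s(r) ▷ m`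
  ract_eq : ∀ (r : R) (m : M), ract (op r) m = act (H.t (op r)) m
  lact_eq : ∀ (r : R) (m : M) {n : ℕ} (x : Fin n → M) (y : Fin n → B), (coact m).Rep x y →
    ∑ i, ract (op (H.counit (H.s r * y i))) (x i) = act (H.s r) m
  -- `(b ▷ m)₀ ⊗ (b ▷ m)₁ = b⁽¹⁾⁺ ▷ m₀ ⊗ b⁽²⁾ m₁ b⁽¹⁾⁻`
  ayd : ∀ (b : B) (m : M) {n p q : ℕ} (b₁ b₂ : Fin n → B) (b₁m b₁p : Fin n → Fin p → B)
    (x : Fin q → M) (y : Fin q → B), (H.comul b).Rep b₁ b₂ →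
    (∀ i, (H.trans (b₁ i)).Rep (b₁m i) (b₁p i)) → (coact m).Rep x y →
    coact (act b m) =
      ∑ i, ∑ j, ∑ l, Bal.tmul _ _ (act (b₁p i j) (x l)) (b₂ i * y l * b₁m i j)
  -- stability `m₁ ▷ m₀ = m`
  stable : ∀ (m : M) {n : ℕ} (x : Fin n → M) (y : Fin n → B), (coact m).Rep x y →
    ∑ i, act (y i) (x i) = m

/-- Left-right SAYD modules over `H`, as objects of a category. -/
structure LeftRightSAYDCat (H : RightTimesHopf k R B) where
  /-- the underlying `k`-module -/
  carrier : Type w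
  [addCommGroup : AddCommGroup carrier]
  [module : Module k carrier]
  /-- the structure maps -/
  str : LeftRightSAYD H carrier

attribute [instance] LeftRightSAYDCat.addCommGroup LeftRightSAYDCat.module

/-- Morphisms: `B`-linear and `B`-colinear maps. -/
@[ext]
structure LeftRightSAYDCat.Hom {H : RightTimesHopf k R B}
    (M N : LeftRightSAYDCat.{uk, uR, uB, w} H) where
  /-- the underlying linear map -/
  toLin : M.carrier →ₗ[k] N.carrier
  map_act : ∀ (b : B) (m : M.carrier), toLin (M.str.act b m) = N.str.act b (toLin m)
  map_coact : ∀ (m : M.carrier) {n : ℕ} (x : Fin n → M.carrier) (y : Fin n → B),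
    (M.str.coact m).Rep x y → N.str.coact (toLin m) = ∑ i, Bal.tmul _ _ (toLin (x i)) (y i)

instance {H : RightTimesHopf k R B} : Category (LeftRightSAYDCat.{uk, uR, uB, w} H) where
  Hom M N := LeftRightSAYDCat.Hom M N
  id M := ⟨LinearMap.id, fun _ _ => rfl, fun _ _ _ _ h => h⟩
  comp f g := ⟨g.toLin ∘ₗ f.toLin, fun κ m => by simp [f.map_act, g.map_act],
    fun m _ x y h => by simpa using g.map_coact _ _ y (f.map_coact m x y h)⟩

end Right

/-! ### Comodule algebras, module algebras, equivariant Galois extensions -/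

section Galois

variable {k : Type uk} [CommRing k] {R : Type uR} [Ring R] [Algebra k R]
  {B : Type uB} [Ring B] [Algebra k B] {K : Type uK} [Ring K] [Algebra k K]
  {T : Type uT} [Ring T] [Algebra k T]

/-- A right comodule algebra `T` over a right bialgebroid: an `R`-bimodule and right comodule with
`R`-balanced multiplication and unital, multiplicative coaction. -/
structure ComoduleAlgebra (H : RightBialgebroid k R B) (T : Type uT) [Ring T] [Algebra k T]
    extends RightComodule H T where
  /-- the left `R`-module structure -/
  lact : R →ₐ[k] Module.End k T
  lact_ract : ∀ (r r' : R) (τ : T), ract (op r') (lact r τ) = lact r (ract (op r') τ)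
  balanced : ∀ (r : R) (τ τ' : T), ract (op r) τ * τ' = τ * lact r τ'
  coact_one : coact 1 = Bal.tmul _ _ 1 1
  coact_mul : ∀ (τ τ' : T) {n n' : ℕ} (x : Fin n → T) (y : Fin n → B) (x' : Fin n' → T)
    (y' : Fin n' → B), (coact τ).Rep x y → (coact τ').Rep x' y' →
    coact (τ * τ') = ∑ i, ∑ j, Bal.tmul _ _ (x i * x' j) (y i * y' j)

namespace ComoduleAlgebra

variable {H : RightBialgebroid k R B} (A : ComoduleAlgebra H T)

theorem coact_mul_coinv {q : T} (hq : A.coact q = Bal.tmul _ _ q 1) (τ : T) {n : ℕ}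
    (x : Fin n → T) (y : Fin n → B) (h : (A.coact τ).Rep x y) :
    A.coact (q * τ) = ∑ i, Bal.tmul _ _ (q * x i) (y i) := by
  have hq' : (A.coact q).Rep (fun _ : Fin 1 => q) (fun _ => (1 : B)) := by
    simpa [Bal.Rep] using hq
  simpa using A.coact_mul q τ _ _ x y hq' h

/-- The subalgebra `S = {q ∈ T | q₀ ⊗ q₁ = q ⊗ 1}` of coinvariants. -/
def coinvariants : Subalgebra k T where
  carrier := {q | A.coact q = Bal.tmul _ _ q 1}
  mul_mem' {q q'} hq hq' := by
    have h : (A.coact q').Rep (fun _ : Fin 1 => q') (fun _ => (1 : B)) := by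
      simpa [Bal.Rep] using hq'
    simpa using A.coact_mul_coinv hq q' _ _ h
  add_mem' {q q'} hq hq' := by
    simp only [Set.mem_ofPred_eq, Bal.tmul, map_add, LinearMap.add_apply] at *
    rw [hq, hq']
  algebraMap_mem' c := by
    have h := A.coact_one
    simp only [Set.mem_ofPred_eq, Bal.tmul, Algebra.algebraMap_eq_smul_one, map_smul,
      LinearMap.smul_apply] at *
    rw [h]

/-- Right multiplication by coinvariants. -/
abbrev coinvR : A.coinvariants → Module.End k T := mulR fun q : A.coinvariants => (q : T)

/-- Left multiplication by coinvariants. -/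
abbrev coinvL : A.coinvariants → Module.End k T := mulL fun q : A.coinvariants => (q : T)

theorem coact_injective : Function.Injective A.coact := by
  intro τ τ' h
  obtain ⟨n, x, y, hx⟩ := (A.coact τ).exists_rep
  rw [← A.coact_counit τ x y hx, ← A.coact_counit τ' x y (h ▸ hx)]

/-- Left multiplications of `T` are right `R`-linear. -/
theorem mul_ract (r : R) (τ τ' : T) :
    τ * A.ract (op r) τ' = A.ract (op r) (τ * τ') := by
  apply A.coact_injective
  obtain ⟨n, x, y, h⟩ := (A.coact τ).exists_rep
  obtain ⟨n', x', y', h'⟩ := (A.coact τ').exists_rep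
  have h1 : (A.coact (A.ract (op r) τ')).Rep x' (fun i => y' i * H.s r) :=
    A.coact_ract r τ' x' y' h'
  have h2 : (A.coact (τ * τ')).Rep (fun i : Fin (n * n') => x i.divNat * x' i.modNat)
      (fun i => y i.divNat * y' i.modNat) := by
    rw [Bal.Rep, A.coact_mul τ τ' x y x' y' h h', ← Fintype.sum_prod_type']
    exact (finProdFinEquiv.symm.sum_comp
      (fun p : Fin n × Fin n' => Bal.tmul _ _ (x p.1 * x' p.2) (y p.1 * y' p.2))).symm
  rw [A.coact_mul _ _ _ _ _ _ h h1, A.coact_ract _ _ _ _ h2, ← Fintype.sum_prod_type']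
  simp only [mul_assoc]
  exact (finProdFinEquiv.symm.sum_comp
      (fun p : Fin n × Fin n' =>
        Bal.tmul _ _ (x p.1 * x' p.2) (y p.1 * (y' p.2 * H.s r)))).symm

/-- `x ⊗ y ↦ (z ↦ z x ⊗ y)` on `T ⊗_R B`. -/
def mulFst : Bal (fun r : R => A.ract (op r)) H.tR →ₗ[k] T →ₗ[k]
    Bal (fun r : R => A.ract (op r)) H.tR :=
  Bal.lift _ _ (LinearMap.mk₂ k
    (fun x y => ((Bal.mk (fun r : R => A.ract (op r)) H.tR).flip y).comp (LinearMap.mulRight k x))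
    (fun x x' y => by ext z; simp [mul_add]) (fun c x y => by ext z; simp)
    (fun x y y' => by ext z; simp) (fun c x y => by ext z; simp))
    (fun r x y => by
      ext z
      simpa [A.mul_ract, Bal.tmul] using
        Bal.tmul_balanced (fun r : R => A.ract (op r)) H.tR r (z * x) y)

theorem mulFst_tmul (x : T) (y : B) (z : T) :
    A.mulFst (Bal.tmul _ _ x y) z = Bal.tmul _ _ (z * x) y := by
  rw [mulFst, Bal.lift_tmul]
  rfl

/-- The canonical map `can : T ⊗_S T → T ⊗_R B`, `τ' ⊗ τ ↦ τ' τ₀ ⊗ τ₁`. -/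
def can : Bal A.coinvR A.coinvL →ₗ[k] Bal (fun r : R => A.ract (op r)) H.tR :=
  Bal.lift _ _ (A.mulFst ∘ₗ A.coact).flip (fun q τ' τ => by
    obtain ⟨n, x, y, h⟩ := (A.coact τ).exists_rep
    have h' := A.coact_mul_coinv q.2 τ x y h
    simp only [LinearMap.flip_apply, LinearMap.comp_apply, LinearMap.mulLeft_apply,
      LinearMap.mulRight_apply]
    rw [h', show A.coact τ = _ from h]
    simp [mulFst_tmul, mul_assoc])

end ComoduleAlgebra

/-- A left module algebra over a left bialgebroid (`act κ τ` is `κ ▷ τ`). -/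
structure ModuleAlgebra (H : LeftBialgebroid k R K) (T : Type uT) [Ring T] [Algebra k T] where
  /-- the left `K`-module structure -/
  act : K →ₐ[k] Module.End k T
  act_one : ∀ κ : K, act κ 1 = act (H.s (H.counit κ)) 1
  act_mul : ∀ (κ : K) (τ τ' : T) {n : ℕ} (x y : Fin n → K), (H.comul κ).Rep x y →
    act κ (τ * τ') = ∑ i, act (x i) τ * act (y i) τ'
  balanced : ∀ (r : R) (τ τ' : T), act (H.t (op r)) τ * τ' = τ * act (H.s r) τ'

/-- `T` is a `K`-equivariant `B`-Galois extension of its coinvariants `S`. -/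
structure IsEquivariantGalois {H : RightTimesHopf k R B}
    (A : ComoduleAlgebra H.toRightBialgebroid T) {L : LeftTimesHopf k A.coinvariants K}
    (E : ModuleAlgebra L.toLeftBialgebroid T) : Prop where
  -- the `S`-ring structure of the `K`-module algebra `T` is the inclusion `S ⊆ T`
  act_s_one : ∀ q : A.coinvariants, E.act (L.s q) 1 = (q : T)
  can_bijective : Function.Bijective A.can
  -- the coaction is `K`-equivariant: `(κ ▷ τ)₀ ⊗ (κ ▷ τ)₁ = κ ▷ τ₀ ⊗ τ₁`
  equivariant : ∀ (κ : K) (τ : T) {n : ℕ} (x : Fin n → T) (y : Fin n → B),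
    (A.coact τ).Rep x y → A.coact (E.act κ τ) = ∑ i, Bal.tmul _ _ (E.act κ (x i)) (y i)

/-- `b ↦ b⁽⁻⁾ ⊗_S b⁽⁺⁾ = can⁻¹(1 ⊗_R b)`. -/
def IsEquivariantGalois.canInv {H : RightTimesHopf k R B}
    {A : ComoduleAlgebra H.toRightBialgebroid T} {L : LeftTimesHopf k A.coinvariants K}
    {E : ModuleAlgebra L.toLeftBialgebroid T} (hE : IsEquivariantGalois A E) (b : B) :
    Bal A.coinvR A.coinvL :=
  (LinearEquiv.ofBijective A.can hE.can_bijective).symm (Bal.tmul _ _ 1 b)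

/-- `M ⊗_K T`, with `(m ◁ κ) ⊗ τ = m ⊗ (κ ▷ τ)`. -/
abbrev tensorOver {L : LeftTimesHopf k R K} (M : RightLeftSAYDCat.{uk, uR, uK, w} L)
    (E : ModuleAlgebra L.toLeftBialgebroid T) : Type (max w uT) :=
  Bal (fun κ : K => M.str.act (op κ)) (fun κ : K => E.act κ)

end Galois

end

/-! The action formula lives on T ⊗_R B but contains an inverse of can; everything is therefore
moved to T ⊗_S T. There `twist` sends α ⊗ β to the map m ↦ m₀ ⊗ β (m₋₁ ▷ α), and `galoisAct` is
`twist` composed with can⁻¹. Since can is left T-linear, can⁻¹(τ ⊗ b) = τb₋ ⊗ b₊, so b ▷ (m ⊗ τ) is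
`galoisAct` of τ ⊗ b evaluated at m. An identity additive in z ∈ T ⊗_R B need only be checked at z =
can(α ⊗ β) = αβ₀ ⊗ β₁, where no inverse is left (`induction_can`).

`twist` is S-balanced by the Takeuchi property of the coaction of M, which itself follows from
coassociativity. The action is K-balanced by the anti Yetter-Drinfeld condition on M and the
identity κ⁻ ▷ (β (κ⁺ ▷ γ)) = (κ ▷ β)γ (`twist_act`). Associativity is `actLin_twist`, a consequence
of stability, coassociativity and the K-equivariance of can. The axioms exchange roles: stability of
M makes 1 ∈ B act as the identity, while the counit of M gives stability of M ⊗_K T.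

The coaction is that of T, and descends to M ⊗_K T because it is K-equivariant. For the anti
Yetter-Drinfeld condition over B, both sides at can(α ⊗ β) become (m₀ ⊗ β₀ (m₋₁ ▷ α₀)) ⊗ β₁α₁; the
surplus legs of β are absorbed by b⁽¹⁾b⁽²⁾⁻ ⊗ b⁽²⁾⁺ = 1 ⊗ b (`tensorCoact_galoisAct`).

Sweedler computations run through `sum_eq_of_coassoc`: a trilinear map is shown to be balanced and
is then evaluated on the two sides of coassociativity. -/

noncomputable section

/-! ### Calculus of balanced tensor products -/

namespace Bal

variable {k : Type*} [CommRing k] {R : Type*} {R' : Type*}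
  {M N P M' N' : Type*} [AddCommGroup M] [Module k M] [AddCommGroup N] [Module k N]
  [AddCommGroup P] [Module k P] [AddCommGroup M'] [Module k M'] [AddCommGroup N'] [Module k N']
  {a : R → Module.End k M} {b : R → Module.End k N}
  {a' : R' → Module.End k M'} {b' : R' → Module.End k N'}

theorem mk_apply (m : M) (n : N) : mk a b m n = tmul a b m n := rfl

theorem add_tmul (m m' : M) (n : N) : tmul a b (m + m') n = tmul a b m n + tmul a b m' n := by
  simp [tmul]

theorem tmul_add (m : M) (n n' : N) : tmul a b m (n + n') = tmul a b m n + tmul a b m n' := by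
  simp [tmul]

theorem smul_tmul (c : k) (m : M) (n : N) : tmul a b (c • m) n = c • tmul a b m n := by
  simp [tmul]

theorem tmul_smul (c : k) (m : M) (n : N) : tmul a b m (c • n) = c • tmul a b m n := by
  simp [tmul]

theorem sum_tmul {ι : Type*} (s : Finset ι) (f : ι → M) (n : N) :
    tmul a b (∑ i ∈ s, f i) n = ∑ i ∈ s, tmul a b (f i) n := by
  simp [tmul]

theorem tmul_sum {ι : Type*} (s : Finset ι) (m : M) (f : ι → N) :
    tmul a b m (∑ i ∈ s, f i) = ∑ i ∈ s, tmul a b m (f i) := by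
  simp [tmul]

@[elab_as_elim]
theorem induction_on {p : Bal a b → Prop} (z : Bal a b) (tmul : ∀ m n, p (tmul a b m n))
    (add : ∀ z z', p z → p z' → p (z + z')) (zero : p 0) : p z := by
  obtain ⟨n, x, y, h⟩ := z.exists_rep
  rw [show z = _ from h]
  exact Finset.sum_induction _ p add zero fun i _ => tmul _ _

theorem hom_ext {f g : Bal a b →ₗ[k] P} (h : ∀ m n, f (tmul a b m n) = g (tmul a b m n)) :
    f = g := by
  ext z
  induction z using induction_on with
  | tmul m n => exact h m n
  | add z z' h h' => rw [map_add, map_add, h, h']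
  | zero => simp

theorem Rep.map_eq {z : Bal a b} {n : ℕ} {x : Fin n → M} {y : Fin n → N} (h : z.Rep x y)
    (f : Bal a b →ₗ[k] P) : f z = ∑ i, f (tmul a b (x i) (y i)) := by
  rw [show z = _ from h, map_sum]

theorem rep_tmul (m : M) (n : N) :
    (tmul a b m n).Rep (fun _ : Fin 1 => m) (fun _ => n) := by
  simp [Rep]

/-- A finite family of elements has representatives of a common length. -/
theorem exists_rep_family {n : ℕ} (z : Fin n → Bal a b) :
    ∃ (p : ℕ) (x : Fin n → Fin p → M) (y : Fin n → Fin p → N), ∀ i, (z i).Rep (x i) (y i) := by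
  choose p x y h using fun i => (z i).exists_rep
  have key : ∀ i, ∃ (x' : Fin (∑ i, p i) → M) (y' : Fin (∑ i, p i) → N), (z i).Rep x' y' := by
    intro i
    have hle : p i ≤ ∑ i, p i := Finset.single_le_sum (fun _ _ => Nat.zero_le _) (Finset.mem_univ i)
    obtain ⟨q, hq⟩ := Nat.exists_eq_add_of_le hle
    rw [hq]
    -- The coassociativity axioms take all inner sums over one index set, so shorter sums are padded
    -- with zero tensors.
    refine ⟨Fin.append (x i) 0, Fin.append (y i) 0, ?_⟩
    rw [Rep, Fin.sum_univ_add]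
    rw [show z i = _ from h i]
    simp [tmul]
  choose x' y' h' using key
  exact ⟨_, x', y', h'⟩

/-- The map `f ⊗ g`. -/
def map (f : M →ₗ[k] M') (g : N →ₗ[k] N') (h : ∀ (r : R) m n,
    tmul a' b' (f (a r m)) (g n) = tmul a' b' (f m) (g (b r n))) : Bal a b →ₗ[k] Bal a' b' :=
  lift a b ((mk a' b').compl₁₂ f g) h

@[simp]
theorem map_tmul (f : M →ₗ[k] M') (g : N →ₗ[k] N') (h : ∀ (r : R) m n,
    tmul a' b' (f (a r m)) (g n) = tmul a' b' (f m) (g (b r n))) (m : M) (n : N) :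
    map f g h (tmul a b m n) = tmul a' b' (f m) (g n) :=
  lift_tmul _ _ _ _ _ _

end Bal

namespace Bal₃

variable {k : Type*} [CommRing k] {R : Type*} {R' : Type*}
  {M N P Q : Type*} [AddCommGroup M] [Module k M] [AddCommGroup N] [Module k N]
  [AddCommGroup P] [Module k P] [AddCommGroup Q] [Module k Q]
  {a : R → Module.End k M} {b : R → Module.End k N} {c : R' → Module.End k N}
  {d : R' → Module.End k P}

variable (a b c d) in
/-- The universal property of the threefold balanced tensor product. -/
def lift (f : M →ₗ[k] N →ₗ[k] P →ₗ[k] Q) (h₁ : ∀ r m n p, f (a r m) n p = f m (b r n) p)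
    (h₂ : ∀ r m n p, f m (c r n) p = f m n (d r p)) : Bal₃ a b c d →ₗ[k] Q :=
  Submodule.liftQ (rel a b c d)
    (TensorProduct.lift ((TensorProduct.uncurry (.id k) N P Q) ∘ₗ f)) (by
    unfold rel
    refine Submodule.span_le.2 ?_
    rintro _ (⟨r, m, n, p, rfl⟩ | ⟨r, m, n, p, rfl⟩)
    · simp [h₁]
    · simp [h₂])

@[simp]
theorem lift_tmul (f : M →ₗ[k] N →ₗ[k] P →ₗ[k] Q) (h₁ : ∀ r m n p, f (a r m) n p = f m (b r n) p)
    (h₂ : ∀ r m n p, f m (c r n) p = f m n (d r p)) (m : M) (n : N) (p : P) :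
    lift a b c d f h₁ h₂ (tmul a b c d m n p) = f m n p := by
  refine (Submodule.liftQ_apply _ _ _).trans ?_
  simp

theorem tmul_balanced_left (r : R) (m : M) (n : N) (p : P) :
    tmul a b c d (a r m) n p = tmul a b c d m (b r n) p := by
  refine (Submodule.Quotient.eq (rel a b c d)).2 ?_
  exact Submodule.subset_span (.inl ⟨r, m, n, p, rfl⟩)

theorem tmul_balanced_right (r : R') (m : M) (n : N) (p : P) :
    tmul a b c d m (c r n) p = tmul a b c d m n (d r p) := by
  refine (Submodule.Quotient.eq (rel a b c d)).2 ?_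
  exact Submodule.subset_span (.inr ⟨r, m, n, p, rfl⟩)

variable (a b c d) in
/-- The quotient map. -/
def proj : M ⊗[k] (N ⊗[k] P) →ₗ[k] Bal₃ a b c d := (rel a b c d).mkQ

variable (a b c d) in
/-- The canonical trilinear map. -/
def mk : M →ₗ[k] N →ₗ[k] P →ₗ[k] Bal₃ a b c d :=
  LinearMap.mk₂ k
    (fun m n => proj a b c d ∘ₗ TensorProduct.mk k M (N ⊗[k] P) m ∘ₗ TensorProduct.mk k N P n)
    (fun m m' n => by ext p; simp) (fun r m n => by ext p; simp)
    (fun m n n' => by ext p; simp [TensorProduct.tmul_add])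
    (fun r m n => by ext p; simp)

@[simp]
theorem mk_apply (m : M) (n : N) (p : P) : mk a b c d m n p = tmul a b c d m n p := rfl

end Bal₃

/-! ### Coassociativity as a rule for trilinear maps -/

section Coassoc

variable {k : Type uk} [CommRing k] {R : Type uR} [Ring R] [Algebra k R]

/-- Coassociativity of a left comodule, applied to a balanced trilinear map. -/
theorem LeftComodule.sum_eq_of_coassoc {K : Type uK} [Ring K] [Algebra k K]
    {H : LeftBialgebroid k R K} {M : Type uM} [AddCommGroup M] [Module k M]
    (C : LeftComodule H M) {P : Type*} [AddCommGroup P] [Module k P]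
    (f : K →ₗ[k] K →ₗ[k] M →ₗ[k] P)
    (h₁ : ∀ r κ κ' m, f (H.t (op r) * κ) κ' m = f κ (H.s r * κ') m)
    (h₂ : ∀ r κ κ' m, f κ (H.t (op r) * κ') m = f κ κ' (C.lact r m))
    (gL gR : K → M → P)
    (hL : ∀ κ m {n : ℕ} (u v : Fin n → K), (H.comul κ).Rep u v → gL κ m = ∑ j, f (u j) (v j) m)
    (hR : ∀ κ m {n : ℕ} (u : Fin n → K) (v : Fin n → M), (C.coact m).Rep u v →
      gR κ m = ∑ j, f κ (u j) (v j))
    {m : M} {n : ℕ} {x : Fin n → K} {y : Fin n → M} (h : (C.coact m).Rep x y) :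
    ∑ i, gL (x i) (y i) = ∑ i, gR (x i) (y i) := by
  obtain ⟨p, u, v, huv⟩ := Bal.exists_rep_family fun i => H.comul (x i)
  obtain ⟨q, u', v', huv'⟩ := Bal.exists_rep_family fun i => C.coact (y i)
  have := congrArg (Bal₃.lift H.tL H.sL H.tL (fun r : R => C.lact r) f h₁ h₂) (C.coact_coassoc m x y u v u' v' h huv huv')
  have key : ∀ x y z, Bal₃.lift H.tL H.sL H.tL (fun r : R => C.lact r) f h₁ h₂ (Bal₃.tmul _ _ _ _ x y z) =
    f x y z := Bal₃.lift_tmul f h₁ h₂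
  simp only [map_sum, key] at this
  simpa only [fun i => hL _ (y i) _ _ (huv i), fun i => hR (x i) _ _ _ (huv' i)] using this

/-- Coassociativity of a right comodule, applied to a balanced trilinear map. -/
theorem RightComodule.sum_eq_of_coassoc {B : Type uB} [Ring B] [Algebra k B]
    {H : RightBialgebroid k R B} {M : Type uM} [AddCommGroup M] [Module k M]
    (C : RightComodule H M) {P : Type*} [AddCommGroup P] [Module k P]
    (f : M →ₗ[k] B →ₗ[k] B →ₗ[k] P)
    (h₁ : ∀ r x y z, f (C.ract (op r) x) y z = f x (y * H.t (op r)) z)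
    (h₂ : ∀ r x y z, f x (y * H.s r) z = f x y (z * H.t (op r)))
    (gL gR : M → B → P)
    (hL : ∀ x y {n : ℕ} (u : Fin n → M) (v : Fin n → B), (C.coact x).Rep u v →
      gL x y = ∑ j, f (u j) (v j) y)
    (hR : ∀ x y {n : ℕ} (u v : Fin n → B), (H.comul y).Rep u v → gR x y = ∑ j, f x (u j) (v j))
    {m : M} {n : ℕ} {x : Fin n → M} {y : Fin n → B} (h : (C.coact m).Rep x y) :
    ∑ i, gL (x i) (y i) = ∑ i, gR (x i) (y i) := by
  obtain ⟨p, u, v, huv⟩ := Bal.exists_rep_family fun i => C.coact (x i)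
  obtain ⟨q, u', v', huv'⟩ := Bal.exists_rep_family fun i => H.comul (y i)
  have := congrArg (Bal₃.lift (fun r : R => C.ract (op r)) H.tR H.sR H.tR f h₁ h₂) (C.coact_coassoc m x y u v u' v' h huv huv')
  have key : ∀ x y z, Bal₃.lift (fun r : R => C.ract (op r)) H.tR H.sR H.tR f h₁ h₂ (Bal₃.tmul _ _ _ _ x y z) =
    f x y z := Bal₃.lift_tmul f h₁ h₂
  simp only [map_sum, key] at this
  simpa only [fun i => hL _ (y i) _ _ (huv i), fun i => hR (x i) _ _ _ (huv' i)] using this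

end Coassoc

/-! ### Comodule algebras and the canonical map -/

section ComoduleAlgebra

variable {k : Type uk} [CommRing k] {R : Type uR} [Ring R] [Algebra k R]
  {B : Type uB} [Ring B] [Algebra k B] {T : Type uT} [Ring T] [Algebra k T]
  {H : RightBialgebroid k R B} (A : ComoduleAlgebra H T)

namespace ComoduleAlgebra

/-- The algebra map `R → T`, `r ↦ 1 r`. -/
def unit (r : R) : T := A.ract (op r) 1

/-- With `balanced` at τ = 1, which identifies left multiplication by `unit r` with the left action
of r, both R-actions on T become multiplications. -/
theorem mul_unit (r : R) (τ : T) : τ * A.unit r = A.ract (op r) τ := by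
  rw [unit, A.mul_ract, mul_one]

theorem coact_unit (r : R) : A.coact (A.unit r) = Bal.tmul _ _ 1 (H.s r) := by
  have h : (A.coact 1).Rep (fun _ : Fin 1 => (1 : T)) (fun _ => (1 : B)) := by
    rw [A.coact_one]
    exact Bal.rep_tmul _ _
  simpa [unit] using A.coact_ract r 1 _ _ h

theorem coact_unit_mul (r : R) {τ : T} {n : ℕ} {x : Fin n → T} {y : Fin n → B}
    (h : (A.coact τ).Rep x y) : (A.coact (A.unit r * τ)).Rep x (fun i => H.s r * y i) := by
  have h' : (A.coact (A.unit r)).Rep (fun _ : Fin 1 => (1 : T)) (fun _ => H.s r) := by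
    rw [A.coact_unit]
    exact Bal.rep_tmul _ _
  simpa [Bal.Rep] using A.coact_mul _ _ _ _ _ _ h' h

/-- The coaction takes values in the Takeuchi product: `r τ₀ ⊗ τ₁ = τ₀ ⊗ t(r) τ₁`. -/
theorem takeuchi (r : R) {τ : T} {n : ℕ} {x : Fin n → T} {y : Fin n → B}
    (h : (A.coact τ).Rep x y) :
    ∑ i, Bal.tmul (fun r : R => A.ract (op r)) H.tR (A.unit r * x i) (y i) =
      ∑ i, Bal.tmul _ _ (x i) (H.t (op r) * y i) := by
  have h₁ : (A.coact 1).Rep (fun _ : Fin 1 => (1 : T)) (fun _ => (1 : B)) := by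
    rw [A.coact_one]
    exact Bal.rep_tmul _ _
  -- Since r ⊗ 1 = 1 ⊗ t(r) in T ⊗_R B, also 1 ⊗ 1 = 1 ⊗ 1 + r ⊗ 1 - 1 ⊗ t(r). Multiplicativity of
  -- the coaction holds for every representative, so the two extra terms, multiplied by τ₀ ⊗ τ₁,
  -- must cancel.
  have h₃ : (A.coact 1).Rep ![1, A.unit r, -1] ![1, 1, H.t (op r)] := by
    have e : Bal.tmul (fun r : R => A.ract (op r)) H.tR (A.unit r) 1 =
        Bal.tmul _ _ 1 (H.t (op r)) := by
      rw [unit, Bal.tmul_balanced (fun r : R => A.ract (op r)) H.tR]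
      simp
    rw [Bal.Rep, A.coact_one, Fin.sum_univ_three]
    simp only [Matrix.cons_val_zero, Matrix.cons_val_one, Matrix.cons_val]
    rw [e]
    simp [Bal.tmul]
  have e₁ := A.coact_mul 1 τ _ _ x y h₁ h
  have e₃ := A.coact_mul 1 τ _ _ x y h₃ h
  rw [e₁, Fin.sum_univ_three] at e₃
  simp [Bal.tmul] at e₃
  simp only [Bal.tmul]
  rw [add_assoc, left_eq_add] at e₃
  exact eq_of_sub_eq_zero (by rw [sub_eq_add_neg, e₃])

theorem sum_takeuchi {P : Type*} [AddCommGroup P] [Module k P] (f : T →ₗ[k] B →ₗ[k] P)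
    (hf : ∀ (r : R) x y, f (A.ract (op r) x) y = f x (y * H.t (op r))) (r : R) {τ : T} {n : ℕ}
    {x : Fin n → T} {y : Fin n → B} (h : (A.coact τ).Rep x y) :
    ∑ i, f (A.unit r * x i) (y i) = ∑ i, f (x i) (H.t (op r) * y i) := by
  have e := congrArg (Bal.lift _ _ f hf) (A.takeuchi r h)
  have key : ∀ x y, Bal.lift (fun r : R => A.ract (op r)) H.tR f hf (Bal.tmul _ _ x y) = f x y :=
    Bal.lift_tmul _ _ f hf
  simpa only [map_sum, key] using e

theorem can_tmul (α β : T) : A.can (Bal.tmul _ _ α β) = A.mulFst (A.coact β) α := by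
  rw [can, Bal.lift_tmul]
  rfl

theorem can_tmul_of_rep (α : T) {β : T} {n : ℕ} {x : Fin n → T} {y : Fin n → B}
    (h : (A.coact β).Rep x y) : (A.can (Bal.tmul _ _ α β)).Rep (fun i => α * x i) y := by
  rw [Bal.Rep, can_tmul, show A.coact β = _ from h]
  simp [mulFst_tmul]

/-- Left multiplication of the first factor of `T ⊗_R B`. -/
def mulLeftFst (τ : T) :
    Bal (fun r : R => A.ract (op r)) H.tR →ₗ[k] Bal (fun r : R => A.ract (op r)) H.tR :=
  Bal.map (LinearMap.mulLeft k τ) LinearMap.id (fun r x y => by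
    simpa [A.mul_ract] using Bal.tmul_balanced (fun r : R => A.ract (op r)) H.tR r (τ * x) y)

theorem mulLeftFst_tmul (τ x : T) (y : B) :
    A.mulLeftFst τ (Bal.tmul _ _ x y) = Bal.tmul _ _ (τ * x) y :=
  Bal.map_tmul _ _ _ _ _

/-- Left multiplication of the second factor of `T ⊗_R B`. -/
def mulLeftSnd (b : B) :
    Bal (fun r : R => A.ract (op r)) H.tR →ₗ[k] Bal (fun r : R => A.ract (op r)) H.tR :=
  Bal.map LinearMap.id (LinearMap.mulLeft k b) (fun r x y => by
    simpa [mul_assoc] using Bal.tmul_balanced (fun r : R => A.ract (op r)) H.tR r x (b * y))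

theorem mulLeftSnd_tmul (b : B) (x : T) (y : B) :
    A.mulLeftSnd b (Bal.tmul _ _ x y) = Bal.tmul _ _ x (b * y) :=
  Bal.map_tmul _ _ _ _ _

theorem mulLeftFst_can (τ : T) (α β : T) :
    A.mulLeftFst τ (A.can (Bal.tmul _ _ α β)) = A.can (Bal.tmul _ _ (τ * α) β) := by
  obtain ⟨n, x, y, h⟩ := (A.coact β).exists_rep
  rw [(A.can_tmul_of_rep α h).map_eq, show A.can _ = _ from A.can_tmul_of_rep (τ * α) h]
  simp [mulLeftFst_tmul, mul_assoc]

end ComoduleAlgebra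

end ComoduleAlgebra

/-! ### Consequences of equivariance and of the Galois condition -/

section Galois

variable {k : Type uk} [CommRing k] {R : Type uR} [Ring R] [Algebra k R]
  {B : Type uB} [Ring B] [Algebra k B] {K : Type uK} [Ring K] [Algebra k K]
  {T : Type uT} [Ring T] [Algebra k T]
  {H : RightTimesHopf k R B} {A : ComoduleAlgebra H.toRightBialgebroid T}
  {L : LeftTimesHopf k A.coinvariants K} {E : ModuleAlgebra L.toLeftBialgebroid T}

namespace IsEquivariantGalois

variable (hE : IsEquivariantGalois A E)
include hE

/-- Because Δ(s(q)) = s(q) ⊗ 1, the module algebra rule applied to 1 · τ leaves (s(q) ▷ 1) τ. -/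
theorem act_s (q : A.coinvariants) (τ : T) : E.act (L.s q) τ = q * τ := by
  have h₁ : (L.comul (1 : K)).Rep (fun _ : Fin 1 => (1 : K)) (fun _ => 1) := by
    rw [L.comul_one]
    exact Bal.rep_tmul _ _
  have h : (L.comul (L.s q)).Rep (fun _ : Fin 1 => L.s q) (fun _ => 1) := by
    simpa [Bal.Rep] using L.comul_s q 1 _ _ h₁
  have := E.act_mul (L.s q) 1 τ _ _ h
  simpa [hE.act_s_one] using this

theorem act_t (q : A.coinvariants) (τ : T) : E.act (L.t (op q)) τ = τ * q := by
  have := E.balanced q τ 1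
  simpa [hE.act_s_one] using this

/-- Both sides have the same coaction, and the coaction of T is injective by counitality. -/
theorem act_ract (κ : K) (r : R) (τ : T) :
    E.act κ (A.ract (op r) τ) = A.ract (op r) (E.act κ τ) := by
  apply A.coact_injective
  obtain ⟨n, x, y, h⟩ := (A.coact τ).exists_rep
  rw [hE.equivariant κ _ _ _ (A.coact_ract r τ x y h),
    A.coact_ract r _ _ _ (hE.equivariant κ τ x y h)]

theorem act_unit_mul (κ : K) (r : R) (τ : T) :
    E.act κ (A.unit r * τ) = A.unit r * E.act κ τ := by
  apply A.coact_injective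
  obtain ⟨n, x, y, h⟩ := (A.coact τ).exists_rep
  rw [hE.equivariant κ _ _ _ (A.coact_unit_mul r h)]
  exact (A.coact_unit_mul r (hE.equivariant κ τ x y h)).symm

/-- The action of `K` on the first factor of `T ⊗_R B`. -/
def actFst (κ : K) :
    Bal (fun r : R => A.ract (op r)) H.tR →ₗ[k] Bal (fun r : R => A.ract (op r)) H.tR :=
  Bal.map (E.act κ) LinearMap.id (fun r x y => by
    simpa [hE.act_ract] using
      Bal.tmul_balanced (fun r : R => A.ract (op r)) H.tR r (E.act κ x) y)

theorem actFst_tmul (κ : K) (x : T) (y : B) :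
    hE.actFst κ (Bal.tmul _ _ x y) = Bal.tmul _ _ (E.act κ x) y :=
  Bal.map_tmul _ _ _ _ _

theorem coact_act (κ : K) (τ : T) : A.coact (E.act κ τ) = hE.actFst κ (A.coact τ) := by
  obtain ⟨n, x, y, h⟩ := (A.coact τ).exists_rep
  rw [hE.equivariant κ τ x y h, h.map_eq]
  simp [actFst_tmul]

theorem mulLeftSnd_actFst (κ : K) (b : B) (z : Bal (fun r : R => A.ract (op r)) H.tR) :
    A.mulLeftSnd b (hE.actFst κ z) = hE.actFst κ (A.mulLeftSnd b z) := by
  induction z using Bal.induction_on with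
  | tmul x y =>
    rw [actFst_tmul, A.mulLeftSnd_tmul, A.mulLeftSnd_tmul, actFst_tmul]
  | add z z' h h' => simp only [map_add, h, h']
  | zero => simp

/-- `can` is `K`-equivariant. -/
theorem actFst_can (κ : K) (α β : T) {n : ℕ} {u v : Fin n → K} (h : (L.comul κ).Rep u v) :
    hE.actFst κ (A.can (Bal.tmul _ _ α β)) =
      ∑ j, A.can (Bal.tmul _ _ (E.act (u j) α) (E.act (v j) β)) := by
  obtain ⟨p, x, y, hβ⟩ := (A.coact β).exists_rep
  have e : ∀ j, A.can (Bal.tmul _ _ (E.act (u j) α) (E.act (v j) β)) = _ :=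
    fun j => A.can_tmul_of_rep (E.act (u j) α) (hE.equivariant (v j) β x y hβ)
  rw [(A.can_tmul_of_rep α hβ).map_eq, Finset.sum_congr rfl fun j _ => e j, Finset.sum_comm]
  refine Finset.sum_congr rfl fun i _ => ?_
  rw [actFst_tmul, E.act_mul κ α (x i) u v h, Bal.sum_tmul]

theorem can_canInv (b : B) : A.can (hE.canInv b) = Bal.tmul _ _ 1 b :=
  (LinearEquiv.ofBijective A.can hE.can_bijective).apply_symm_apply _

/-- Left T-linearity of can: this is can⁻¹(τ ⊗ b) = τb₋ ⊗ b₊, read through can. -/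
theorem can_mul_canInv (τ : T) (b : B) {n : ℕ} {u v : Fin n → T} (h : (hE.canInv b).Rep u v) :
    ∑ j, A.can (Bal.tmul _ _ (τ * u j) (v j)) = Bal.tmul _ _ τ b := by
  have e := hE.can_canInv b
  rw [h.map_eq] at e
  have := congrArg (A.mulLeftFst τ) e
  simpa only [map_sum, A.mulLeftFst_can, A.mulLeftFst_tmul, mul_one] using this

omit hE in
/-- The product `x ⊗ y ↦ x β₀ ⊗ y β₁`. -/
theorem exists_mulRight (β : T) {p : ℕ} {x : Fin p → T} {y : Fin p → B}
    (hβ : (A.coact β).Rep x y) :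
    ∃ f : Bal (fun r : R => A.ract (op r)) H.tR →ₗ[k] Bal (fun r : R => A.ract (op r)) H.tR,
      ∀ x' y', f (Bal.tmul _ _ x' y') = ∑ i, Bal.tmul _ _ (x' * x i) (y' * y i) := by
  refine ⟨Bal.lift _ _ (LinearMap.mk₂ k (fun x' y' => ∑ i, Bal.tmul _ _ (x' * x i) (y' * y i))
      (by intros; simp [add_mul, Bal.add_tmul, Finset.sum_add_distrib])
      (by intros; simp [Bal.smul_tmul, Finset.smul_sum])
      (by intros; simp [add_mul, Bal.tmul_add, Finset.sum_add_distrib])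
      (by intros; simp [Bal.tmul_smul, Finset.smul_sum])) ?_, fun x' y' => ?_⟩
  · intro r x' y'
    -- Multiplication by β₀ ⊗ β₁ on the right respects the balancing exactly because rβ₀ ⊗ β₁ = β₀ ⊗
    -- t(r)β₁.
    have := congrArg (fun z => A.mulLeftFst x' (A.mulLeftSnd y' z)) (A.takeuchi r hβ)
    simpa only [map_sum, A.mulLeftFst_tmul, A.mulLeftSnd_tmul, ← mul_assoc, A.mul_unit,
      LinearMap.mk₂_apply, LinearMap.mulRight_apply] using this
  · exact Bal.lift_tmul _ _ _ _ _ _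

/-- `α b⁽⁻⁾ ⊗ b⁽⁺⁾ β` is mapped by `can` to `α β₀ ⊗ b β₁`. -/
theorem can_canInv_mul (α β : T) (b : B) {n : ℕ} {u v : Fin n → T}
    (h : (hE.canInv b).Rep u v) :
    ∑ j, A.can (Bal.tmul _ _ (α * u j) (v j * β)) =
      A.mulLeftSnd b (A.can (Bal.tmul _ _ α β)) := by
  obtain ⟨p, x, y, hβ⟩ := (A.coact β).exists_rep
  obtain ⟨q, u', v', hv⟩ := Bal.exists_rep_family fun j => A.coact (v j)
  obtain ⟨f, hf⟩ := exists_mulRight β hβ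
  -- The coaction is multiplicative, so a right factor β in the second argument of can multiplies
  -- the result by β₀ ⊗ β₁.
  have e : ∑ j, A.can (Bal.tmul _ _ (α * u j) (v j * β)) =
      f (∑ j, A.can (Bal.tmul _ _ (α * u j) (v j))) := by
    rw [map_sum]
    refine Finset.sum_congr rfl fun j _ => ?_
    rw [(A.can_tmul_of_rep (α * u j) (hv j)).map_eq, A.can_tmul,
      A.coact_mul _ _ _ _ _ _ (hv j) hβ]
    simp only [hf, map_sum, LinearMap.sum_apply, A.mulFst_tmul, mul_assoc]
  rw [e, hE.can_mul_canInv α b h, hf, (A.can_tmul_of_rep α hβ).map_eq]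
  simp only [A.mulLeftSnd_tmul]

theorem act_one (κ : K) : E.act κ 1 = L.counit κ := by
  rw [E.act_one, hE.act_s_one]

end IsEquivariantGalois

theorem LeftBialgebroid.nu_tmul {R : Type uR} [Ring R] [Algebra k R]
    (L : LeftBialgebroid k R K) (x y : K) :
    L.nu (Bal.tmul _ _ x y) = L.mulSnd (L.comul x) y :=
  Bal.lift_tmul _ _ _ _ _ _

/-- `κ⁻ ▷ (β (κ⁺ ▷ γ)) = (κ ▷ β) γ`. -/
theorem ModuleAlgebra.sum_act_trans {R : Type uR} [Ring R] [Algebra k R]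
    {L : LeftTimesHopf k R K} (E : ModuleAlgebra L.toLeftBialgebroid T) (κ : K) (β γ : T)
    {n : ℕ} {u v : Fin n → K} (h : (L.trans κ).Rep u v) :
    ∑ j, E.act (u j) (β * E.act (v j) γ) = E.act κ β * γ := by
  have e : L.nu (L.trans κ) = Bal.tmul _ _ κ 1 :=
    (LinearEquiv.ofBijective L.nu L.nu_bijective).apply_symm_apply _
  let f : K →ₗ[k] K →ₗ[k] T :=
    LinearMap.mk₂ k (fun κ κ' => E.act κ β * E.act κ' γ)
      (by intros; simp [add_mul]) (by intros; simp) (by intros; simp [mul_add]) (by intros; simp)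
  have hf : ∀ (r : R) x y, f (L.tL r x) y = f x (L.sL r y) := by
    intro r x y
    simpa [f] using E.balanced r (E.act x β) (E.act y γ)
  have key : ∀ x y, Bal.lift L.tL L.sL f hf (Bal.tmul _ _ x y) = f x y :=
    Bal.lift_tmul _ _ f hf
  -- Composing the lift of `f` with ν turns the module algebra rule around. Evaluating at κ⁻ ⊗ κ⁺,
  -- whose image under ν is κ ⊗ 1, then gives the claim.
  have hnu : ∀ x y, Bal.lift L.tL L.sL f hf (L.nu (Bal.tmul _ _ x y)) =
      E.act x (β * E.act y γ) := by
    intro x y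
    obtain ⟨p, u', v', hx⟩ := (L.comul x).exists_rep
    rw [L.nu_tmul, E.act_mul x _ _ _ _ hx]
    rw [show L.comul x = _ from hx]
    simp only [map_sum, LinearMap.sum_apply, L.mulSnd_tmul, key]
    simp [f]
  rw [h.map_eq] at e
  have := congrArg (Bal.lift L.tL L.sL f hf) e
  simp only [map_sum, hnu, key] at this
  rw [this]
  simp [f]

end Galois

/-! ### Takeuchi property of the coaction of M -/

section LeftCoring

variable {k : Type uk} [CommRing k] {R : Type uR} [Ring R] [Algebra k R]
  {K : Type uK} [Ring K] [Algebra k K]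

/-- The Takeuchi condition trades s(r) on the second leg for t(r) on the first; the counit axiom
then restores κ. -/
theorem LeftBialgebroid.sum_t_counit_mul_s (L : LeftBialgebroid k R K) (r : R) (κ : K) {n : ℕ}
    {x y : Fin n → K} (h : (L.comul κ).Rep x y) :
    ∑ i, L.t (op (L.counit (y i * L.s r))) * x i = κ * L.t (op r) := by
  let f : K →ₗ[k] K →ₗ[k] K :=
    LinearMap.mk₂ k (fun κ κ' => L.t (op (L.counit κ')) * κ)
      (by intros; simp [mul_add]) (by intros; simp) (by intros; simp [add_mul]) (by intros; simp)
  have hf : ∀ (r : R) x y, f (L.tL r x) y = f x (L.sL r y) := by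
    intro r x y
    simp [f, L.counit_s, mul_assoc]
  have key : ∀ x y, Bal.lift L.tL L.sL f hf (Bal.tmul _ _ x y) = f x y :=
    Bal.lift_tmul _ _ f hf
  have e := congrArg (Bal.lift L.tL L.sL f hf) (L.takeuchi r κ x y h)
  simp only [map_sum, key] at e
  simp only [f, LinearMap.mk₂_apply] at e
  rw [← e]
  simp only [← mul_assoc, ← Finset.sum_mul]
  rw [L.counit_right κ x y h]

/-- The coaction takes values in a Takeuchi product: `m₋₁ t(r) ⊗ m₀ = m₋₁ ⊗ m₀ ◁ s(r)`. -/
theorem RightLeftSAYD.sum_takeuchi {L : LeftTimesHopf k R K} {M : Type uM} [AddCommGroup M]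
    [Module k M] (S : RightLeftSAYD L M) {P : Type*} [AddCommGroup P] [Module k P]
    (f : K →ₗ[k] M →ₗ[k] P) (hf : ∀ r κ m, f (L.t (op r) * κ) m = f κ (S.lact r m)) (r : R)
    {m : M} {n : ℕ} {x : Fin n → K} {y : Fin n → M} (h : (S.coact m).Rep x y) :
    ∑ i, f (x i * L.t (op r)) (y i) = ∑ i, f (x i) (S.act (op (L.s r)) (y i)) := by
  -- Write m₀ ◁ s(r) as ε(m₀₋₁ s(r)) m₀₀. Coassociativity moves the counit to the second leg of
  -- Δ(m₋₁), where `sum_t_counit_mul_s` turns it into m₋₁ t(r).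
  refine S.sum_eq_of_coassoc (LinearMap.mk₂ k
      (fun κ κ' => f κ ∘ₗ S.lact (L.counit (κ' * L.s r)))
      (by intros; ext; simp) (by intros; ext; simp) (by intros; ext; simp [add_mul])
      (by intros; ext; simp)) ?_ ?_ (fun κ m => f (κ * L.t (op r)) m)
      (fun κ m => f κ (S.act (op (L.s r)) m)) ?_ ?_ h
  · intro r' κ κ' m
    simp [hf, mul_assoc, L.counit_s]
  · intro r' κ κ' m
    simp [mul_assoc, L.counit_t]
  · intro κ m n u v huv
    simp only [LinearMap.mk₂_apply, LinearMap.comp_apply, ← hf]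
    rw [← L.sum_t_counit_mul_s r κ huv]
    simp
  · intro κ m n u v huv
    simp only [LinearMap.mk₂_apply, LinearMap.comp_apply]
    rw [← S.ract_eq r m u v huv, map_sum]

end LeftCoring

/-! ### The action of B on M ⊗_K T -/

section Galois

variable {k : Type uk} [CommRing k] {R : Type uR} [Ring R] [Algebra k R]
  {B : Type uB} [Ring B] [Algebra k B] {K : Type uK} [Ring K] [Algebra k K]
  {T : Type uT} [Ring T] [Algebra k T]
  {H : RightTimesHopf k R B} {A : ComoduleAlgebra H.toRightBialgebroid T}
  {L : LeftTimesHopf k A.coinvariants K} {E : ModuleAlgebra L.toLeftBialgebroid T}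
  {M : Type uM} [AddCommGroup M] [Module k M]

namespace RightLeftSAYD

/-- `M ⊗_K T`, with `(m ◁ κ) ⊗ τ = m ⊗ (κ ▷ τ)`. -/
abbrev tensor (S : RightLeftSAYD L M) (E : ModuleAlgebra L.toLeftBialgebroid T) :
    Type (max uM uT) :=
  Bal (fun κ : K => S.act (op κ)) (fun κ : K => E.act κ)

variable (S : RightLeftSAYD L M)

variable (E) in
/-- The elementary tensor `m ⊗_K τ`. -/
abbrev tprod (m : M) (τ : T) : S.tensor E :=
  Bal.tmul (fun κ : K => S.act (op κ)) (fun κ : K => E.act κ) m τ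

theorem tprod_sum {ι : Type*} (s : Finset ι) (m : M) (f : ι → T) :
    S.tprod E m (∑ i ∈ s, f i) = ∑ i ∈ s, S.tprod E m (f i) :=
  Bal.tmul_sum _ _ _

theorem act_tprod (κ : K) (m : M) (τ : T) :
    S.tprod E (S.act (op κ) m) τ = S.tprod E m (E.act κ τ) :=
  Bal.tmul_balanced (fun κ : K => S.act (op κ)) (fun κ : K => E.act κ) κ m τ

variable (hE : IsEquivariantGalois A E)
include hE

/-- The map `κ ⊗ m ↦ m ⊗ β (κ ▷ α)`. -/
def twistAux (α β : T) : Bal L.tL (fun q : A.coinvariants => S.lact q) →ₗ[k] S.tensor E :=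
  Bal.lift _ _ (LinearMap.mk₂ k (fun κ m => S.tprod E m (β * E.act κ α))
    (by intros; simp [mul_add, Bal.tmul_add]) (by intros; simp [Bal.tmul_smul])
    (by intros; simp [Bal.add_tmul]) (by intros; simp [Bal.smul_tmul]))
    (by
      intro q κ m
      -- Both sides are m ⊗ β (κ ▷ α) q, since t(q) acts on T as right multiplication by q.
      simp [S.lact_eq, S.act_tprod, hE.act_t, mul_assoc])

theorem twistAux_tmul (α β : T) (κ : K) (m : M) :
    S.twistAux hE α β (Bal.tmul _ _ κ m) = S.tprod E m (β * E.act κ α) :=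
  Bal.lift_tmul _ _ _ _ _ _

/-- The map `α ⊗ β ↦ (m ↦ m₀ ⊗ β (m₋₁ ▷ α))`. -/
def twist : Bal A.coinvR A.coinvL →ₗ[k] M →ₗ[k] S.tensor E :=
  Bal.lift _ _ (LinearMap.mk₂ k (fun α β => S.twistAux hE α β ∘ₗ S.coact)
    (by
      intro α α' β
      rw [← LinearMap.add_comp]
      congr 1
      exact Bal.hom_ext fun κ m => by
        simp [twistAux_tmul, mul_add, Bal.tmul_add])
    (by
      intro c α β
      rw [← LinearMap.smul_comp]
      congr 1
      exact Bal.hom_ext fun κ m => by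
        simp [twistAux_tmul, Bal.tmul_smul])
    (by
      intro α β β'
      rw [← LinearMap.add_comp]
      congr 1
      exact Bal.hom_ext fun κ m => by
        simp [twistAux_tmul, add_mul, Bal.tmul_add])
    (by
      intro c α β
      rw [← LinearMap.smul_comp]
      congr 1
      exact Bal.hom_ext fun κ m => by
        simp [twistAux_tmul, Bal.tmul_smul]))
    (by
      intro q α β
      ext m
      obtain ⟨n, x, y, h⟩ := (S.coact m).exists_rep
      -- A factor q on the right of α is t(q) ▷ α, and one on the left of β comes from m₀ ◁ s(q).
      -- The Takeuchi property of the coaction of M exchanges the two.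
      have := S.sum_takeuchi (LinearMap.mk₂ k (fun κ m => S.tprod E m (β * E.act κ α))
        (by intros; simp [mul_add, Bal.tmul_add]) (by intros; simp [Bal.tmul_smul])
        (by intros; simp [Bal.add_tmul]) (by intros; simp [Bal.smul_tmul]))
        (by
          intro q κ m
          simp [S.lact_eq, S.act_tprod, hE.act_t, mul_assoc]) q h
      simp only [LinearMap.mk₂_apply, S.act_tprod, hE.act_s, map_mul, Module.End.mul_apply,
        hE.act_t] at this
      simpa [h.map_eq, twistAux_tmul, mul_assoc] using this)

theorem twist_tmul (α β : T) {m : M} {n : ℕ} {x : Fin n → K} {y : Fin n → M}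
    (h : (S.coact m).Rep x y) :
    S.twist hE (Bal.tmul _ _ α β) m = ∑ i, S.tprod E (y i) (β * E.act (x i) α) := by
  rw [twist, Bal.lift_tmul]
  simp [h.map_eq, twistAux_tmul]

/-- The map `τ ⊗ b ↦ (m ↦ b ▷ (m ⊗ τ))`. -/
def galoisAct : Bal (fun r : R => A.ract (op r)) H.tR →ₗ[k] M →ₗ[k] S.tensor E :=
  S.twist hE ∘ₗ (LinearEquiv.ofBijective A.can hE.can_bijective).symm.toLinearMap

theorem galoisAct_can (z : Bal A.coinvR A.coinvL) (m : M) :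
    S.galoisAct hE (A.can z) m = S.twist hE z m := by
  have e : (LinearEquiv.ofBijective A.can hE.can_bijective).symm (A.can z) = z :=
    (LinearEquiv.ofBijective A.can hE.can_bijective).symm_apply_apply z
  simp [galoisAct, e]

omit hE in
-- Surjectivity of can reduces additive statements to elements on which `galoisAct` is given by the
-- explicit formula for `twist`.
theorem _root_.IsEquivariantGalois.induction_can (hE : IsEquivariantGalois A E)
    {p : Bal (fun r : R => A.ract (op r)) H.tR → Prop}
    (z : Bal (fun r : R => A.ract (op r)) H.tR) (can : ∀ α β, p (A.can (Bal.tmul _ _ α β)))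
    (add : ∀ z z', p z → p z' → p (z + z')) (zero : p 0) : p z := by
  obtain ⟨w, rfl⟩ := hE.can_bijective.2 z
  induction w using Bal.induction_on with
  | tmul α β => exact can α β
  | add w w' h h' => rw [map_add]; exact add _ _ h h'
  | zero => rwa [map_zero]

/-- By the anti Yetter-Drinfeld condition the left side is m₀ ⊗ κ⁽²⁾⁻ ▷ (β (κ⁽²⁾⁺ m₋₁ κ⁽¹⁾ ▷ α)).
The identity `sum_act_trans` collapses κ⁽²⁾⁻ and κ⁽²⁾⁺ to leave (κ⁽²⁾ ▷ β)(m₋₁ κ⁽¹⁾ ▷ α). -/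
theorem twist_act (κ : K) (α β : T) (m : M) {n : ℕ} {u v : Fin n → K}
    (h : (L.comul κ).Rep u v) :
    S.twist hE (Bal.tmul _ _ α β) (S.act (op κ) m) =
      ∑ j, S.twist hE (Bal.tmul _ _ (E.act (u j) α) (E.act (v j) β)) m := by
  obtain ⟨q, x, y, hm⟩ := (S.coact m).exists_rep
  obtain ⟨p, v₁, v₂, hv⟩ := Bal.exists_rep_family fun j => L.trans (v j)
  have e : S.twist hE (Bal.tmul _ _ α β) (S.act (op κ) m) =
      S.twistAux hE α β (S.coact (S.act (op κ) m)) := by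
    rw [twist, Bal.lift_tmul]
    rfl
  rw [e, S.ayd κ m u v v₁ v₂ x y h hv hm]
  simp only [map_sum, twistAux_tmul, S.twist_tmul hE _ _ hm, S.act_tprod]
  refine Finset.sum_congr rfl fun i _ => ?_
  rw [Finset.sum_comm]
  refine Finset.sum_congr rfl fun l _ => ?_
  rw [← Bal.tmul_sum]
  congr 1
  simpa [mul_assoc] using E.sum_act_trans (v i) β (E.act (x l) (E.act (u i) α)) (hv i)

theorem galoisAct_act (κ : K) (z : Bal (fun r : R => A.ract (op r)) H.tR) (m : M) :
    S.galoisAct hE z (S.act (op κ) m) = S.galoisAct hE (hE.actFst κ z) m := by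
  induction z using hE.induction_can with
  | can α β =>
    obtain ⟨n, u, v, h⟩ := (L.comul κ).exists_rep
    rw [galoisAct_can, S.twist_act hE κ α β m h, hE.actFst_can κ α β h, map_sum,
      LinearMap.sum_apply]
    simp only [galoisAct_can]
  | add z z' h h' => simp only [map_add, LinearMap.add_apply, h, h']
  | zero => simp

/-- Substitute m = m₀ ◁ m₋₁ and let m₋₁ pass to z; this is how stability enters associativity. -/
theorem galoisAct_stable (z : Bal (fun r : R => A.ract (op r)) H.tR) {m : M} {n : ℕ}
    {x : Fin n → K} {y : Fin n → M} (h : (S.coact m).Rep x y) :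
    S.galoisAct hE z m = ∑ i, S.galoisAct hE (hE.actFst (x i) z) (y i) := by
  conv_lhs => rw [← S.stable m x y h]
  rw [map_sum]
  simp only [galoisAct_act]

/-- The action of `b` on `M ⊗_K T`. -/
def actLin (b : B) : S.tensor E →ₗ[k] S.tensor E :=
  Bal.lift _ _ (LinearMap.mk₂ k (fun m τ => S.galoisAct hE (Bal.tmul _ _ τ b) m)
    (by intros; simp) (by intros; simp) (by intros; simp [Bal.add_tmul])
    (by intros; simp [Bal.smul_tmul]))
    (by
      intro κ m τ
      simp [galoisAct_act, hE.actFst_tmul])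

theorem actLin_tprod (b : B) (m : M) (τ : T) :
    S.actLin hE b (S.tprod E m τ) = S.galoisAct hE (Bal.tmul _ _ τ b) m :=
  Bal.lift_tmul _ _ _ _ _ _

theorem actLin_tprod_of_rep (b : B) (m : M) (τ : T) {n p : ℕ}
    {x : Fin n → K} {y : Fin n → M} {u v : Fin p → T} (hm : (S.coact m).Rep x y)
    (hb : (hE.canInv b).Rep u v) :
    S.actLin hE b (S.tprod E m τ) =
      ∑ i, ∑ j, S.tprod E (y i) (v j * E.act (x i) (τ * u j)) := by
  rw [actLin_tprod, ← hE.can_mul_canInv τ b hb, map_sum, LinearMap.sum_apply, Finset.sum_comm]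
  simp only [galoisAct_can, S.twist_tmul hE _ _ hm]

omit hE in
-- Stability of M after m₋₁ is moved across ⊗_K.
theorem sum_tprod_act (m : M) (τ : T) {n : ℕ} {x : Fin n → K} {y : Fin n → M}
    (h : (S.coact m).Rep x y) : ∑ i, S.tprod E (y i) (E.act (x i) τ) = S.tprod E m τ := by
  conv_rhs => rw [← S.stable m x y h]
  simp only [← S.act_tprod, Bal.sum_tmul]

/-- Since τ ⊗ 1 = can(τ ⊗ 1), the unit sends m ⊗ τ to m₀ ⊗ (m₋₁ ▷ τ), which stability identifies
with m ⊗ τ. -/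
theorem actLin_one : S.actLin hE 1 = LinearMap.id := by
  refine Bal.hom_ext fun m τ => ?_
  have e : A.can (Bal.tmul _ _ τ 1) = Bal.tmul _ _ τ 1 := by
    rw [A.can_tmul, A.coact_one, A.mulFst_tmul, mul_one]
  obtain ⟨n, x, y, h⟩ := (S.coact m).exists_rep
  rw [actLin_tprod, ← e, galoisAct_can, S.twist_tmul hE _ _ h]
  simp only [one_mul, S.sum_tprod_act m τ h, LinearMap.id_apply]

/-- Expand m₋₁ ▷ (βα) by the coproduct; coassociativity turns the second leg of Δ(m₋₁) into the
coaction of m₀. -/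
theorem twist_mul (α β γ : T) {m : M} {n : ℕ} {x : Fin n → K} {y : Fin n → M}
    (h : (S.coact m).Rep x y) :
    S.twist hE (Bal.tmul _ _ (β * α) γ) m =
      ∑ i, S.twist hE (Bal.tmul _ _ α (γ * E.act (x i) β)) (y i) := by
  rw [S.twist_tmul hE _ _ h]
  refine S.sum_eq_of_coassoc (LinearMap.mk₂ k
      (fun κ κ' => (Bal.mk _ _).flip (γ * (E.act κ β * E.act κ' α)))
      (by intros; ext; simp [mul_add, add_mul]) (by intros; ext; simp)
      (by intros; ext; simp [mul_add]) (by intros; ext; simp)) ?_ ?_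
      (fun κ m => S.tprod E m (γ * E.act κ (β * α)))
      (fun κ m => S.twist hE (Bal.tmul _ _ α (γ * E.act κ β)) m) ?_ ?_ h
  · intro q κ κ' m
    simp [hE.act_t, hE.act_s, mul_assoc]
  · intro q κ κ' m
    simp [Bal.mk_apply, S.lact_eq, S.act_tprod, hE.act_t, mul_assoc]
  · intro κ m n u v huv
    simp [Bal.mk_apply, E.act_mul κ β α u v huv, Finset.mul_sum, Bal.tmul_sum]
  · intro κ m n u v huv
    simp [Bal.mk_apply, S.twist_tmul hE _ _ huv, mul_assoc]

/-- `b ▷ (m₀ ⊗ β (m₋₁ ▷ α)) = (m ↦ αβ₀ ⊗ bβ₁)`. -/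
theorem actLin_twist (b : B) (α β : T) (m : M) :
    S.actLin hE b (S.twist hE (Bal.tmul _ _ α β) m) =
      S.galoisAct hE (A.mulLeftSnd b (A.can (Bal.tmul _ _ α β))) m := by
  obtain ⟨n, x, y, h⟩ := (S.coact m).exists_rep
  obtain ⟨p, u, v, hb⟩ := (hE.canInv b).exists_rep
  -- Stability inserts m₋₁ on the right-hand side too. Equivariance of can splits it over α and β,
  -- and coassociativity then compares the two expressions.
  rw [S.twist_tmul hE _ _ h, map_sum, S.galoisAct_stable hE _ h]
  simp only [actLin_tprod, ← hE.mulLeftSnd_actFst]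
  symm
  refine S.sum_eq_of_coassoc (LinearMap.mk₂ k
      (fun κ κ' => S.galoisAct hE
        (A.mulLeftSnd b (A.can (Bal.tmul _ _ (E.act κ α) (E.act κ' β)))))
      (by intros; simp [Bal.add_tmul]) (by intros; simp [Bal.smul_tmul])
      (by intros; simp [Bal.tmul_add]) (by intros; simp [Bal.tmul_smul])) ?_ ?_
      (fun κ m => S.galoisAct hE (A.mulLeftSnd b (hE.actFst κ (A.can (Bal.tmul _ _ α β)))) m)
      (fun κ m => S.galoisAct hE (Bal.tmul _ _ (β * E.act κ α) b) m) ?_ ?_ h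
  · intro q κ κ' m
    have := Bal.tmul_balanced A.coinvR A.coinvL q (E.act κ α) (E.act κ' β)
    simp only [LinearMap.mulLeft_apply, LinearMap.mulRight_apply] at this
    simp [hE.act_t, hE.act_s, this]
  · intro q κ κ' m
    -- Since Δ(t(q)) = 1 ⊗ t(q), right multiplication of the second argument by q is t(q) acting on
    -- the whole of can, hence equivalent to t(q) acting on m.
    have e : A.can (Bal.tmul _ _ (E.act κ α) (E.act κ' β * (q : T))) =
        hE.actFst (L.t (op q)) (A.can (Bal.tmul _ _ (E.act κ α) (E.act κ' β))) := by
      have hq : (L.comul (L.t (op q))).Rep (fun _ : Fin 1 => 1) (fun _ => L.t (op q)) := by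
        have h₁ : (L.comul (1 : K)).Rep (fun _ : Fin 1 => (1 : K)) (fun _ => 1) := by
          rw [L.comul_one]
          exact Bal.rep_tmul _ _
        simpa [Bal.Rep] using L.comul_t q 1 _ _ h₁
      rw [hE.actFst_can _ _ _ hq]
      simp [hE.act_t]
    simp [hE.act_t, S.lact_eq, galoisAct_act, ← hE.mulLeftSnd_actFst, e]
  · intro κ m n u v huv
    simp [hE.actFst_can _ _ _ huv]
  · intro κ m n x y hm
    -- With β(κ ▷ α) ⊗ b = can(β(κ ▷ α)b₋ ⊗ b₊), `twist_mul` carries the factor β to the second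
    -- argument, giving (κ ▷ α)b₋ ⊗ b₊(m₋₁ ▷ β) at m₀.
    simp only [← hE.can_mul_canInv (β * E.act κ α) b hb, ← hE.can_canInv_mul _ _ b hb,
      LinearMap.mk₂_apply, map_sum, LinearMap.sum_apply, galoisAct_can]
    rw [Finset.sum_comm]
    refine Finset.sum_congr rfl fun j _ => ?_
    rw [mul_assoc, S.twist_mul hE _ _ _ hm]

theorem actLin_mul (b b' : B) : S.actLin hE (b * b') = S.actLin hE b ∘ₗ S.actLin hE b' := by
  refine Bal.hom_ext fun m τ => ?_
  -- Additivity extends `actLin_twist` to all of T ⊗_R B; associativity is the case z = τ ⊗ b'.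
  have key : ∀ z, S.galoisAct hE (A.mulLeftSnd b z) m =
      S.actLin hE b (S.galoisAct hE z m) := by
    intro z
    induction z using hE.induction_can with
    | can α β => rw [galoisAct_can, actLin_twist]
    | add z z' h h' => simp only [map_add, LinearMap.add_apply, h, h']
    | zero => simp
  rw [LinearMap.comp_apply, actLin_tprod, actLin_tprod, ← key, A.mulLeftSnd_tmul]

/-- The left `B`-module structure of `M ⊗_K T`. -/
def tensorAct : B →ₐ[k] Module.End k (S.tensor E) :=
  AlgHom.ofLinearMap
    { toFun := S.actLin hE
      map_add' := fun b b' => Bal.hom_ext fun m τ => by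
        simp [actLin_tprod, Bal.tmul_add]
      map_smul' := fun c b => Bal.hom_ext fun m τ => by
        simp [actLin_tprod, Bal.tmul_smul] }
    (S.actLin_one hE) (S.actLin_mul hE)

theorem tensorAct_apply (b : B) : S.tensorAct hE b = S.actLin hE b := rfl

end RightLeftSAYD

end Galois

/-! ### Comodule axioms as identities of linear maps -/

section RightCoring

variable {k : Type uk} [CommRing k] {R : Type uR} [Ring R] [Algebra k R]
  {B : Type uB} [Ring B] [Algebra k B]

namespace RightBialgebroid

variable (H : RightBialgebroid k R B) {Q : Type*} [AddCommGroup Q] [Module k Q]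
  (ρ : Rᵐᵒᵖ →ₐ[k] Module.End k Q)

/-- The right multiplication by `s(r)` on `Q ⊗_R B`. -/
def mulSSnd (r : R) :
    Bal (fun r : R => ρ (op r)) H.tR →ₗ[k] Bal (fun r : R => ρ (op r)) H.tR :=
  Bal.map LinearMap.id (LinearMap.mulRight k (H.s r)) (fun r' x y => by
    have := Bal.tmul_balanced (fun r : R => ρ (op r)) H.tR r' x (y * H.s r)
    simp only [LinearMap.mulRight_apply, mul_assoc] at this
    -- Multiplication by s(r) preserves the balancing because s and t have commuting ranges.
    simp [mul_assoc, this, H.s_comm_t])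

theorem mulSSnd_tmul (r : R) (x : Q) (y : B) :
    H.mulSSnd ρ r (Bal.tmul _ _ x y) = Bal.tmul _ _ x (y * H.s r) :=
  Bal.map_tmul _ _ _ _ _

/-- The map `x ⊗ y ↦ x ε(b y)`. -/
def counitSnd (b : B) : Bal (fun r : R => ρ (op r)) H.tR →ₗ[k] Q :=
  Bal.lift _ _ (LinearMap.mk₂ k (fun x y => ρ (op (H.counit (b * y))) x)
    (by intros; simp) (by intros; simp) (by intros; simp [mul_add])
    (by intros; simp))
    (fun r x y => by simp [← mul_assoc, H.counit_t])

theorem counitSnd_tmul (b : B) (x : Q) (y : B) :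
    H.counitSnd ρ b (Bal.tmul _ _ x y) = ρ (op (H.counit (b * y))) x :=
  Bal.lift_tmul _ _ _ _ _ _

/-- The map `x ⊗ z ↦ x ⊗ z ⊗ y`. -/
def assocLeft (y : B) : Bal (fun r : R => ρ (op r)) H.tR →ₗ[k]
    Bal₃ (fun r : R => ρ (op r)) H.tR H.sR H.tR :=
  Bal.lift _ _ (LinearMap.mk₂ k (fun x z => Bal₃.mk _ _ _ _ x z y)
    (by intros; simp only [map_add, LinearMap.add_apply])
    (by intros; simp only [map_smul, LinearMap.smul_apply])
    (by intros; simp only [map_add, LinearMap.add_apply])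
    (by intros; simp only [map_smul, LinearMap.smul_apply]))
    (fun r x z => Bal₃.tmul_balanced_left (c := H.sR) (d := H.tR) r x z y)

theorem assocLeft_tmul (y : B) (x : Q) (z : B) :
    H.assocLeft ρ y (Bal.tmul _ _ x z) = Bal₃.mk _ _ _ _ x z y :=
  Bal.lift_tmul _ _ _ _ _ _

/-- The map `z ⊗ y ↦ x ⊗ z ⊗ y`. -/
def assocRight (x : Q) : Bal H.sR H.tR →ₗ[k]
    Bal₃ (fun r : R => ρ (op r)) H.tR H.sR H.tR :=
  Bal.lift _ _ (Bal₃.mk _ _ _ _ x)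
    (fun r z y => Bal₃.tmul_balanced_right (a := fun r : R => ρ (op r)) (b := H.tR) r x z y)

theorem assocRight_tmul (x : Q) (z y : B) :
    H.assocRight ρ x (Bal.tmul _ _ z y) = Bal₃.mk _ _ _ _ x z y :=
  Bal.lift_tmul _ _ _ _ _ _

theorem assocLeft_add (y y' : B) : H.assocLeft ρ (y + y') = H.assocLeft ρ y + H.assocLeft ρ y' :=
  Bal.hom_ext fun x z => by simp only [assocLeft_tmul, map_add, LinearMap.add_apply]

theorem assocLeft_smul (c : k) (y : B) : H.assocLeft ρ (c • y) = c • H.assocLeft ρ y :=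
  Bal.hom_ext fun x z => by simp only [assocLeft_tmul, map_smul, LinearMap.smul_apply]

theorem assocRight_add (x x' : Q) :
    H.assocRight ρ (x + x') = H.assocRight ρ x + H.assocRight ρ x' :=
  Bal.hom_ext fun y z => by simp only [assocRight_tmul, map_add, LinearMap.add_apply]

theorem assocRight_smul (c : k) (x : Q) : H.assocRight ρ (c • x) = c • H.assocRight ρ x :=
  Bal.hom_ext fun y z => by simp only [assocRight_tmul, map_smul, LinearMap.smul_apply]

/-- The map `(id ⊗ Δ)`. -/
def comulSnd : Bal (fun r : R => ρ (op r)) H.tR →ₗ[k]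
    Bal₃ (fun r : R => ρ (op r)) H.tR H.sR H.tR :=
  Bal.lift _ _ (LinearMap.mk₂ k (fun x y => H.assocRight ρ x (H.comul y))
    (by intros; simp [assocRight_add]) (by intros; simp [assocRight_smul])
    (by intros; simp) (by intros; simp))
    (fun r x y => by
      obtain ⟨n, u, v, h⟩ := (H.comul y).exists_rep
      simp only [LinearMap.mk₂_apply, LinearMap.mulRight_apply]
      rw [H.comul_t r y u v h, h.map_eq]
      simp only [map_sum, assocRight_tmul]
      exact Finset.sum_congr rfl fun i _ =>
        Bal₃.tmul_balanced_left (c := H.sR) (d := H.tR) r x (u i) (v i))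

theorem comulSnd_tmul (x : Q) (y : B) :
    H.comulSnd ρ (Bal.tmul _ _ x y) = H.assocRight ρ x (H.comul y) :=
  Bal.lift_tmul _ _ _ _ _ _

variable {ρ} (δ : Q →ₗ[k] Bal (fun r : R => ρ (op r)) H.tR)
  (hδ : ∀ r q, δ (ρ (op r) q) = H.mulSSnd ρ r (δ q))

/-- The map `(δ ⊗ id)`. -/
def coactFst : Bal (fun r : R => ρ (op r)) H.tR →ₗ[k]
    Bal₃ (fun r : R => ρ (op r)) H.tR H.sR H.tR :=
  Bal.lift _ _ (LinearMap.mk₂ k (fun x y => H.assocLeft ρ y (δ x))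
    (by intros; simp) (by intros; simp)
    (by intros; simp [assocLeft_add]) (by intros; simp [assocLeft_smul]))
    (fun r x y => by
      obtain ⟨n, u, v, h⟩ := (δ x).exists_rep
      simp only [LinearMap.mk₂_apply, LinearMap.mulRight_apply]
      rw [hδ, show δ x = _ from h]
      simp only [map_sum, assocLeft_tmul, mulSSnd_tmul]
      exact Finset.sum_congr rfl fun i _ =>
        Bal₃.tmul_balanced_right (a := fun r : R => ρ (op r)) (b := H.tR) r (u i) (v i) y)

theorem coactFst_tmul (x : Q) (y : B) :
    H.coactFst δ hδ (Bal.tmul _ _ x y) = H.assocLeft ρ y (δ x) :=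
  Bal.lift_tmul _ _ _ _ _ _

/-- A right comodule from coassociativity and counitality in the form of identities of maps. -/
def mkComodule (h_coassoc : ∀ q, H.coactFst δ hδ (δ q) = H.comulSnd ρ (δ q))
    (h_counit : ∀ q, H.counitSnd ρ 1 (δ q) = q) : RightComodule H Q where
  ract := ρ
  coact := δ
  coact_ract r q n x y h := by
    rw [hδ, h.map_eq]
    simp only [mulSSnd_tmul]
  coact_coassoc q n p p' x y u v u' v' h hu hu' := by
    have e := h_coassoc q
    rw [h.map_eq, h.map_eq] at e
    simp only [coactFst_tmul, comulSnd_tmul] at e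
    rw [Finset.sum_congr rfl fun i _ => (hu i).map_eq _,
      Finset.sum_congr rfl fun i _ => (hu' i).map_eq _] at e
    simp only [assocLeft_tmul, assocRight_tmul] at e
    exact e
  coact_counit q n x y h := by
    have e := h_counit q
    rw [h.map_eq] at e
    simpa only [counitSnd_tmul, one_mul] using e

end RightBialgebroid

end RightCoring

/-! ### The coaction of B on M ⊗_K T -/

section Galois

variable {k : Type uk} [CommRing k] {R : Type uR} [Ring R] [Algebra k R]
  {B : Type uB} [Ring B] [Algebra k B] {K : Type uK} [Ring K] [Algebra k K]
  {T : Type uT} [Ring T] [Algebra k T]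
  {H : RightTimesHopf k R B} {A : ComoduleAlgebra H.toRightBialgebroid T}
  {L : LeftTimesHopf k A.coinvariants K} {E : ModuleAlgebra L.toLeftBialgebroid T}
  {M : Type uM} [AddCommGroup M] [Module k M]

namespace RightLeftSAYD

variable (S : RightLeftSAYD L M) (hE : IsEquivariantGalois A E)
include hE

/-- The right action of `r` on `M ⊗_K T`. -/
def ractLin (r : Rᵐᵒᵖ) : S.tensor E →ₗ[k] S.tensor E :=
  Bal.map LinearMap.id (A.ract r) (fun κ m τ => by
    have := hE.act_ract κ r.unop τ
    rw [op_unop] at this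
    rw [← this]
    exact S.act_tprod κ m _)

theorem ractLin_tprod (r : Rᵐᵒᵖ) (m : M) (τ : T) :
    S.ractLin hE r (S.tprod E m τ) = S.tprod E m (A.ract r τ) :=
  Bal.map_tmul _ _ _ _ _

/-- The right `R`-module structure of `M ⊗_K T`. -/
def tensorRact : Rᵐᵒᵖ →ₐ[k] Module.End k (S.tensor E) :=
  AlgHom.ofLinearMap
    { toFun := S.ractLin hE
      map_add' := fun r r' => Bal.hom_ext fun m τ => by
        simp [ractLin_tprod, Bal.tmul_add]
      map_smul' := fun c r => Bal.hom_ext fun m τ => by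
        simp [ractLin_tprod, Bal.tmul_smul] }
    (Bal.hom_ext fun m τ => by simp [ractLin_tprod])
    (fun r r' => Bal.hom_ext fun m τ => by simp [ractLin_tprod])

theorem tensorRact_tprod (r : Rᵐᵒᵖ) (m : M) (τ : T) :
    S.tensorRact hE r (S.tprod E m τ) = S.tprod E m (A.ract r τ) :=
  S.ractLin_tprod hE r m τ

/-- The map `τ ⊗ b ↦ (m ⊗ τ) ⊗ b`. -/
def tprodFst (m : M) : Bal (fun r : R => A.ract (op r)) H.tR →ₗ[k]
    Bal (fun r : R => S.tensorRact hE (op r)) H.tR :=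
  Bal.map (Bal.mk _ _ m) LinearMap.id (fun r x y => by
    have := Bal.tmul_balanced (fun r : R => S.tensorRact hE (op r)) H.tR r (S.tprod E m x) y
    rwa [tensorRact_tprod] at this)

theorem tprodFst_tmul (m : M) (τ : T) (b : B) :
    S.tprodFst hE m (Bal.tmul _ _ τ b) = Bal.tmul _ _ (S.tprod E m τ) b :=
  Bal.map_tmul _ _ _ _ _

theorem tprodFst_act (κ : K) (m : M) (z : Bal (fun r : R => A.ract (op r)) H.tR) :
    S.tprodFst hE (S.act (op κ) m) z = S.tprodFst hE m (hE.actFst κ z) := by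
  induction z using Bal.induction_on with
  | tmul τ b => rw [hE.actFst_tmul, tprodFst_tmul, tprodFst_tmul, act_tprod]
  | add z z' h h' => simp only [map_add, h, h']
  | zero => simp

/-- The coaction of `B` on `M ⊗_K T`. -/
def tensorCoact : S.tensor E →ₗ[k] Bal (fun r : R => S.tensorRact hE (op r)) H.tR :=
  Bal.lift _ _ (LinearMap.mk₂ k (fun m τ => S.tprodFst hE m (A.coact τ))
    (by
      intro m m' τ
      have : S.tprodFst hE (m + m') = S.tprodFst hE m + S.tprodFst hE m' :=
        Bal.hom_ext fun τ b => by simp [tprodFst_tmul, Bal.add_tmul]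
      simp [this])
    (by
      intro c m τ
      have : S.tprodFst hE (c • m) = c • S.tprodFst hE m :=
        Bal.hom_ext fun τ b => by simp [tprodFst_tmul, Bal.smul_tmul]
      simp [this])
    (by intros; simp) (by intros; simp))
    (by
      intro κ m τ
      simp [tprodFst_act, hE.coact_act])

theorem tensorCoact_tprod (m : M) (τ : T) :
    S.tensorCoact hE (S.tprod E m τ) = S.tprodFst hE m (A.coact τ) :=
  Bal.lift_tmul _ _ _ _ _ _

theorem tensorCoact_rep (m : M) {τ : T} {n : ℕ} {x : Fin n → T} {y : Fin n → B}
    (h : (A.coact τ).Rep x y) :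
    (S.tensorCoact hE (S.tprod E m τ)).Rep (fun i => S.tprod E m (x i)) y := by
  rw [Bal.Rep, tensorCoact_tprod, h.map_eq]
  simp only [tprodFst_tmul]

theorem tensorCoact_ract (r : R) (q : S.tensor E) :
    S.tensorCoact hE (S.tensorRact hE (op r) q) =
      H.mulSSnd (S.tensorRact hE) r (S.tensorCoact hE q) := by
  induction q using Bal.induction_on with
  | tmul m τ =>
    obtain ⟨n, x, y, h⟩ := (A.coact τ).exists_rep
    rw [tensorRact_tprod, tensorCoact_tprod, A.coact_ract r τ x y h,
      (S.tensorCoact_rep hE m h).map_eq, map_sum]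
    simp only [tprodFst_tmul, RightBialgebroid.mulSSnd_tmul]
  | add q q' h h' => simp only [map_add, h, h']
  | zero => simp

/-- Coassociativity of T pushed forward along the right R-linear map τ ↦ m ⊗ τ. -/
theorem tensorCoact_coassoc_tprod (m : M) (τ : T) :
    H.coactFst (S.tensorCoact hE) (S.tensorCoact_ract hE) (S.tensorCoact hE (S.tprod E m τ)) =
      H.comulSnd (S.tensorRact hE) (S.tensorCoact hE (S.tprod E m τ)) := by
  obtain ⟨n, x, y, h⟩ := (A.coact τ).exists_rep
  rw [(S.tensorCoact_rep hE m h).map_eq, (S.tensorCoact_rep hE m h).map_eq]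
  simp only [RightBialgebroid.coactFst_tmul, RightBialgebroid.comulSnd_tmul]
  refine A.sum_eq_of_coassoc
    (Bal₃.mk (fun r : R => S.tensorRact hE (op r)) H.tR H.sR H.tR ∘ₗ
      Bal.mk (fun κ : K => S.act (op κ)) (fun κ : K => E.act κ) m) (fun r x y z => ?_)
    (fun r x y z => ?_)
    (fun x y => H.assocLeft (S.tensorRact hE) y (S.tensorCoact hE (S.tprod E m x)))
    (fun x y => H.assocRight (S.tensorRact hE) (S.tprod E m x) (H.comul y))
    (fun x y n u v huv => ?_) (fun x y n u v huv => ?_) h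
  · have := Bal₃.tmul_balanced_left (a := fun r : R => S.tensorRact hE (op r))
      (b := H.tR) (c := H.sR) (d := H.tR) r (S.tprod E m x) y z
    rwa [tensorRact_tprod] at this
  · exact Bal₃.tmul_balanced_right (a := fun r : R => S.tensorRact hE (op r))
      (b := H.tR) (c := H.sR) (d := H.tR) r (S.tprod E m x) y z
  · refine ((S.tensorCoact_rep hE m huv).map_eq _).trans (Finset.sum_congr rfl fun j _ => ?_)
    exact RightBialgebroid.assocLeft_tmul _ _ _ _ _
  · refine (huv.map_eq _).trans (Finset.sum_congr rfl fun j _ => ?_)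
    exact RightBialgebroid.assocRight_tmul _ _ _ _ _

/-- The right comodule `M ⊗_K T`. -/
def tensorComodule : RightComodule H.toRightBialgebroid (S.tensor E) :=
  H.mkComodule (S.tensorCoact hE) (S.tensorCoact_ract hE)
    (fun q => by
      induction q using Bal.induction_on with
      | tmul m τ => exact S.tensorCoact_coassoc_tprod hE m τ
      | add q q' h h' => simp only [map_add, h, h']
      | zero => simp)
    (fun q => by
      induction q using Bal.induction_on with
      | tmul m τ =>
        obtain ⟨n, x, y, h⟩ := (A.coact τ).exists_rep
        rw [(S.tensorCoact_rep hE m h).map_eq]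
        simp only [RightBialgebroid.counitSnd_tmul, one_mul, tensorRact_tprod]
        rw [← Bal.tmul_sum, A.coact_counit τ x y h]
      | add q q' h h' => simp only [map_add, h, h']
      | zero => simp)

end RightLeftSAYD

end Galois

/-! ### The translation map b ↦ b⁻ ⊗ b⁺ -/

section RightHopf

variable {k : Type uk} [CommRing k] {R : Type uR} [Ring R] [Algebra k R]
  {B : Type uB} [Ring B] [Algebra k B]

theorem RightBialgebroid.nu_tmul (H : RightBialgebroid k R B) (x y : B) :
    H.nu (Bal.tmul _ _ x y) = H.mulFst (H.comul y) x :=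
  Bal.lift_tmul _ _ _ _ _ _

theorem RightBialgebroid.nu_tmul_of_rep (H : RightBialgebroid k R B) (x : B) {y : B} {n : ℕ}
    {u v : Fin n → B} (h : (H.comul y).Rep u v) :
    H.nu (Bal.tmul _ _ x y) = ∑ i, Bal.tmul _ _ (x * u i) (v i) := by
  rw [nu_tmul, show H.comul y = _ from h]
  simp only [map_sum, LinearMap.sum_apply, H.mulFst_tmul]

namespace RightTimesHopf

variable (H : RightTimesHopf k R B)

theorem nu_trans (b : B) : H.nu (H.trans b) = Bal.tmul _ _ 1 b :=
  (LinearEquiv.ofBijective H.nu H.nu_bijective).apply_symm_apply _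

/-- `b ↦ b⁻ ⊗ b⁺` as a linear map. -/
def transLin : B →ₗ[k] Bal H.tR H.tL :=
  (LinearEquiv.ofBijective H.nu H.nu_bijective).symm.toLinearMap ∘ₗ Bal.mk _ _ 1

/-- Left multiplication on the first factor of `B ⊗_{Rᵒᵖ} B`. -/
def mulLeftFst (c : B) : Bal H.tR H.tL →ₗ[k] Bal H.tR H.tL :=
  Bal.map (LinearMap.mulLeft k c) LinearMap.id (fun r x y => by
    simpa [mul_assoc] using Bal.tmul_balanced H.tR H.tL r (c * x) y)

theorem mulLeftFst_tmul (c x y : B) :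
    H.mulLeftFst c (Bal.tmul _ _ x y) = Bal.tmul _ _ (c * x) y :=
  Bal.map_tmul _ _ _ _ _

/-- Right multiplication on the second factor of `B ⊗_{Rᵒᵖ} B`. -/
def mulRightSnd (c : B) : Bal H.tR H.tL →ₗ[k] Bal H.tR H.tL :=
  Bal.map LinearMap.id (LinearMap.mulRight k c) (fun r x y => by
    simpa [mul_assoc] using Bal.tmul_balanced H.tR H.tL r x (y * c))

theorem mulRightSnd_tmul (c x y : B) :
    H.mulRightSnd c (Bal.tmul _ _ x y) = Bal.tmul _ _ x (y * c) :=
  Bal.map_tmul _ _ _ _ _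

theorem nu_mulLeftFst (c : B) {w : Bal H.tR H.tL} {n : ℕ} {u v : Fin n → B}
    (h : (H.nu w).Rep u v) : H.nu (H.mulLeftFst c w) = ∑ i, Bal.tmul _ _ (c * u i) (v i) := by
  have key : ∀ w, H.nu (H.mulLeftFst c w) = H.mulFst (H.nu w) c := by
    intro w
    induction w using Bal.induction_on with
    | tmul x y =>
      obtain ⟨n, u, v, h⟩ := (H.comul y).exists_rep
      rw [mulLeftFst_tmul, H.nu_tmul_of_rep _ h, H.nu_tmul_of_rep _ h]
      simp only [map_sum, LinearMap.sum_apply, H.mulFst_tmul, mul_assoc]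
    | add w w' h h' => simp only [map_add, LinearMap.add_apply, h, h']
    | zero => simp
  rw [key, show H.nu w = _ from h]
  simp only [map_sum, LinearMap.sum_apply, H.mulFst_tmul]

/-- Right multiplication by `s(r)` on the second factor of `B ⊗_R B`. -/
def tensorMulS (r : R) : Bal H.sR H.tR →ₗ[k] Bal H.sR H.tR :=
  Bal.map LinearMap.id (LinearMap.mulRight k (H.s r)) (fun r' x y => by
    have := Bal.tmul_balanced H.sR H.tR r' x (y * H.s r)
    simp only [LinearMap.mulRight_apply, mul_assoc] at this
    simp [mul_assoc, this, H.s_comm_t])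

theorem tensorMulS_tmul (r : R) (x y : B) :
    H.tensorMulS r (Bal.tmul _ _ x y) = Bal.tmul _ _ x (y * H.s r) :=
  Bal.map_tmul _ _ _ _ _

/-- Right multiplication by `t(r)` on the first factor of `B ⊗_R B`. -/
def tensorMulT (r : R) : Bal H.sR H.tR →ₗ[k] Bal H.sR H.tR :=
  Bal.map (LinearMap.mulRight k (H.t (op r))) LinearMap.id (fun r' x y => by
    have := Bal.tmul_balanced H.sR H.tR r' (x * H.t (op r)) y
    simp only [LinearMap.mulRight_apply, mul_assoc] at this
    simp [mul_assoc, ← this, H.s_comm_t])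

theorem tensorMulT_tmul (r : R) (x y : B) :
    H.tensorMulT r (Bal.tmul _ _ x y) = Bal.tmul _ _ (x * H.t (op r)) y :=
  Bal.map_tmul _ _ _ _ _

theorem nu_mulRightSnd_s (r : R) (w : Bal H.tR H.tL) :
    H.nu (H.mulRightSnd (H.s r) w) = H.tensorMulS r (H.nu w) := by
  induction w using Bal.induction_on with
  | tmul x y =>
    obtain ⟨n, u, v, h⟩ := (H.comul y).exists_rep
    rw [mulRightSnd_tmul, H.nu_tmul_of_rep _ h, H.nu_tmul_of_rep _ (H.comul_s r y u v h), map_sum]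
    simp only [tensorMulS_tmul]
  | add w w' h h' => simp only [map_add, h, h']
  | zero => simp

theorem nu_mulRightSnd_t (r : R) (w : Bal H.tR H.tL) :
    H.nu (H.mulRightSnd (H.t (op r)) w) = H.tensorMulT r (H.nu w) := by
  induction w using Bal.induction_on with
  | tmul x y =>
    obtain ⟨n, u, v, h⟩ := (H.comul y).exists_rep
    rw [mulRightSnd_tmul, H.nu_tmul_of_rep _ h, H.nu_tmul_of_rep _ (H.comul_t r y u v h), map_sum]
    simp only [tensorMulT_tmul, mul_assoc]
  | add w w' h h' => simp only [map_add, h, h']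
  | zero => simp

/-- Like the other translation identities, checked after the injective map ν: both sides become 1 ⊗
b s(r). -/
theorem trans_mul_s (b : B) (r : R) : H.trans (b * H.s r) = H.mulRightSnd (H.s r) (H.trans b) := by
  apply H.nu_bijective.1
  rw [nu_mulRightSnd_s, nu_trans, nu_trans, tensorMulS_tmul]

/-- In B ⊗_R B one has 1 ⊗ b t(r) = s(r) ⊗ b, and ν is left B-linear. -/
theorem trans_mul_t (b : B) (r : R) :
    H.trans (b * H.t (op r)) = H.mulLeftFst (H.s r) (H.trans b) := by
  apply H.nu_bijective.1
  have h : (H.nu (H.trans b)).Rep (fun _ : Fin 1 => 1) (fun _ => b) := by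
    rw [nu_trans]
    exact Bal.rep_tmul _ _
  rw [H.nu_mulLeftFst _ h, nu_trans]
  simpa using (Bal.tmul_balanced H.sR H.tR r 1 b).symm

/-- Both sides have image t(r) ⊗ b under ν. -/
theorem mulRightSnd_t_trans (b : B) (r : R) :
    H.mulRightSnd (H.t (op r)) (H.trans b) = H.mulLeftFst (H.t (op r)) (H.trans b) := by
  apply H.nu_bijective.1
  have h : (H.nu (H.trans b)).Rep (fun _ : Fin 1 => 1) (fun _ => b) := by
    rw [nu_trans]
    exact Bal.rep_tmul _ _
  rw [nu_mulRightSnd_t, H.nu_mulLeftFst _ h, nu_trans, tensorMulT_tmul]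
  simp

/-- This is b⁽¹⁾b⁽²⁾⁻ ⊗ b⁽²⁾⁺ = 1 ⊗ b: under ν both sides are b⁽¹⁾ ⊗ b⁽²⁾. -/
theorem sum_mulLeftFst_trans {b : B} {n : ℕ} {u v : Fin n → B} (h : (H.comul b).Rep u v) :
    ∑ i, H.mulLeftFst (u i) (H.trans (v i)) = Bal.tmul _ _ 1 b := by
  apply H.nu_bijective.1
  rw [H.nu_tmul_of_rep _ h, map_sum]
  refine Finset.sum_congr rfl fun i _ => ?_
  have h : (H.nu (H.trans (v i))).Rep (fun _ : Fin 1 => 1) (fun _ => v i) := by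
    rw [nu_trans]
    exact Bal.rep_tmul _ _
  rw [H.nu_mulLeftFst _ h]
  simp

variable {Q : Type*} [AddCommGroup Q] [Module k Q] (ρ : Rᵐᵒᵖ →ₐ[k] Module.End k Q)
  (α : B →ₐ[k] Module.End k Q) (hρ : ∀ r q, ρ (op r) q = α (H.t (op r)) q)

/-- The map `x ⊗ z ↦ (z ▷ q) ⊗ e x`. -/
def actTmul (q : Q) (e : B) : Bal H.tR H.tL →ₗ[k] Bal (fun r : R => ρ (op r)) H.tR :=
  Bal.lift _ _ (LinearMap.mk₂ k (fun x z => Bal.tmul _ _ (α z q) (e * x))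
    (by intros; simp [mul_add, Bal.tmul_add]) (by intros; simp [Bal.tmul_smul])
    (by intros; simp [Bal.add_tmul]) (by intros; simp [Bal.smul_tmul]))
    (fun r x z => by
      have := Bal.tmul_balanced (fun r : R => ρ (op r)) H.tR r (α z q) (e * x)
      simp only [hρ, LinearMap.mulRight_apply] at this
      simp [← mul_assoc, this])

theorem actTmul_tmul (q : Q) (e x z : B) :
    H.actTmul ρ α hρ q e (Bal.tmul _ _ x z) = Bal.tmul _ _ (α z q) (e * x) :=
  Bal.lift_tmul _ _ _ _ _ _

/-- The trilinear map `(q, e, b) ↦ (b⁺ ▷ q) ⊗ e b⁻`. -/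
def transAct : Q →ₗ[k] B →ₗ[k] B →ₗ[k] Bal (fun r : R => ρ (op r)) H.tR :=
  LinearMap.mk₂ k (fun q e => H.actTmul ρ α hρ q e ∘ₗ H.transLin)
    (fun q q' e => by
      rw [← LinearMap.add_comp]
      congr 1
      exact Bal.hom_ext fun x z => by simp [actTmul_tmul, Bal.add_tmul])
    (fun c q e => by
      rw [← LinearMap.smul_comp]
      congr 1
      exact Bal.hom_ext fun x z => by simp [actTmul_tmul, Bal.smul_tmul])
    (fun q e e' => by
      rw [← LinearMap.add_comp]
      congr 1
      exact Bal.hom_ext fun x z => by simp [actTmul_tmul, add_mul, Bal.tmul_add])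
    (fun c q e => by
      rw [← LinearMap.smul_comp]
      congr 1
      exact Bal.hom_ext fun x z => by simp [actTmul_tmul, Bal.tmul_smul])

theorem transAct_apply (q : Q) (e b : B) :
    H.transAct ρ α hρ q e b = H.actTmul ρ α hρ q e (H.trans b) := rfl

theorem transAct_of_rep (q : Q) (e : B) {b : B} {n : ℕ} {x z : Fin n → B}
    (h : (H.trans b).Rep x z) :
    H.transAct ρ α hρ q e b = ∑ i, Bal.tmul _ _ (α (z i) q) (e * x i) := by
  rw [transAct_apply, h.map_eq]
  simp only [actTmul_tmul]

theorem transAct_mul_s (q : Q) (e b : B) (r : R) :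
    H.transAct ρ α hρ q e (b * H.s r) = H.transAct ρ α hρ (α (H.s r) q) e b := by
  obtain ⟨n, x, z, h⟩ := (H.trans b).exists_rep
  rw [H.transAct_of_rep ρ α hρ _ _ h, transAct_apply, trans_mul_s, h.map_eq, map_sum]
  simp only [mulRightSnd_tmul, actTmul_tmul, map_mul, Module.End.mul_apply]

theorem transAct_mul_t (q : Q) (e b : B) (r : R) :
    H.transAct ρ α hρ q e (b * H.t (op r)) = H.transAct ρ α hρ q (e * H.s r) b := by
  obtain ⟨n, x, z, h⟩ := (H.trans b).exists_rep
  rw [H.transAct_of_rep ρ α hρ _ _ h, transAct_apply, trans_mul_t, h.map_eq, map_sum]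
  simp only [mulLeftFst_tmul, actTmul_tmul, mul_assoc]

/-- Follows from b⁻ ⊗ b⁺t(r) = t(r)b⁻ ⊗ b⁺; it is the balancing that lets `transActSnd` be defined
on Q ⊗_R B. -/
theorem transAct_ract (q : Q) (e b : B) (r : R) :
    H.transAct ρ α hρ (ρ (op r) q) e b = H.transAct ρ α hρ q (e * H.t (op r)) b := by
  obtain ⟨n, x, z, h⟩ := (H.trans b).exists_rep
  have e' := congrArg (H.actTmul ρ α hρ q e) (H.mulRightSnd_t_trans b r)
  rw [h.map_eq, h.map_eq, map_sum, map_sum] at e'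
  simp only [mulLeftFst_tmul, mulRightSnd_tmul, actTmul_tmul, map_mul, Module.End.mul_apply] at e'
  rw [H.transAct_of_rep ρ α hρ _ _ h, H.transAct_of_rep ρ α hρ _ _ h, hρ, e']
  simp only [mul_assoc]

theorem sum_transAct (q : Q) (e : B) {b : B} {n : ℕ} {u v : Fin n → B}
    (h : (H.comul b).Rep u v) :
    ∑ i, H.transAct ρ α hρ q (e * u i) (v i) = Bal.tmul _ _ (α b q) e := by
  have := congrArg (H.actTmul ρ α hρ q e) (H.sum_mulLeftFst_trans h)
  rw [actTmul_tmul, mul_one] at this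
  rw [← this, map_sum]
  refine Finset.sum_congr rfl fun i _ => ?_
  obtain ⟨n, x, z, h⟩ := (H.trans (v i)).exists_rep
  rw [H.transAct_of_rep ρ α hρ _ _ h, h.map_eq, map_sum]
  simp only [mulLeftFst_tmul, actTmul_tmul, mul_assoc]

/-- The map `x ⊗ y ↦ (b⁺ ▷ x) ⊗ e y b⁻`. -/
def transActSnd (e b : B) :
    Bal (fun r : R => ρ (op r)) H.tR →ₗ[k] Bal (fun r : R => ρ (op r)) H.tR :=
  Bal.lift _ _ (LinearMap.mk₂ k (fun x y => H.transAct ρ α hρ x (e * y) b)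
    (by intros; simp) (by intros; simp) (by intros; simp [mul_add]) (by intros; simp))
    (fun r x y => by simp [transAct_ract, mul_assoc])

theorem transActSnd_tmul (e b : B) (x : Q) (y : B) :
    H.transActSnd ρ α hρ e b (Bal.tmul _ _ x y) = H.transAct ρ α hρ x (e * y) b :=
  Bal.lift_tmul _ _ _ _ _ _

end RightTimesHopf

end RightHopf

/-! ### Compatibility of action and coaction on M ⊗_K T -/

section Galois

variable {k : Type uk} [CommRing k] {R : Type uR} [Ring R] [Algebra k R]
  {B : Type uB} [Ring B] [Algebra k B] {K : Type uK} [Ring K] [Algebra k K]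
  {T : Type uT} [Ring T] [Algebra k T]
  {H : RightTimesHopf k R B} {A : ComoduleAlgebra H.toRightBialgebroid T}
  {L : LeftTimesHopf k A.coinvariants K} {E : ModuleAlgebra L.toLeftBialgebroid T}
  {M : Type uM} [AddCommGroup M] [Module k M]

namespace RightLeftSAYD

variable (S : RightLeftSAYD L M) (hE : IsEquivariantGalois A E)
include hE

theorem tensorAct_tprod (b : B) (m : M) (τ : T) :
    S.tensorAct hE b (S.tprod E m τ) = S.galoisAct hE (Bal.tmul _ _ τ b) m :=
  S.actLin_tprod hE b m τ

/-- Here τ ⊗ s(r) = can(τ ⊗ r), so the action gives m₀ ⊗ r(m₋₁ ▷ τ). As K commutes with left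
multiplication by r, stability finishes. -/
theorem tensorAct_s (r : R) (m : M) (τ : T) :
    S.tensorAct hE (H.s r) (S.tprod E m τ) = S.tprod E m (A.unit r * τ) := by
  have e : A.can (Bal.tmul _ _ τ (A.unit r)) = Bal.tmul _ _ τ (H.s r) := by
    rw [A.can_tmul, A.coact_unit, A.mulFst_tmul, mul_one]
  obtain ⟨n, x, y, h⟩ := (S.coact m).exists_rep
  rw [tensorAct_tprod, ← e, galoisAct_can, S.twist_tmul hE _ _ h]
  simp only [← hE.act_unit_mul, S.sum_tprod_act m _ h]

/-- Since τ ⊗ t(r) = τr ⊗ 1, this reduces to 1 acting as the identity. -/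
theorem tensorRact_eq (r : R) (q : S.tensor E) :
    S.tensorRact hE (op r) q = S.tensorAct hE (H.t (op r)) q := by
  induction q using Bal.induction_on with
  | tmul m τ =>
    have := Bal.tmul_balanced (fun r : R => A.ract (op r)) H.tR r τ 1
    simp only [LinearMap.mulRight_apply, one_mul] at this
    rw [tensorRact_tprod, tensorAct_tprod, ← this, ← tensorAct_tprod, map_one, Module.End.one_apply]
  | add q q' h h' => simp only [map_add, h, h']
  | zero => simp

/-- The coaction of rτ is τ₀ ⊗ s(r)τ₁, so counitality of T gives τ₀ ε(s(r)τ₁) = rτ. -/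
theorem counitSnd_tensorCoact (r : R) (q : S.tensor E) :
    H.counitSnd (S.tensorRact hE) (H.s r) (S.tensorCoact hE q) = S.tensorAct hE (H.s r) q := by
  induction q using Bal.induction_on with
  | tmul m τ =>
    obtain ⟨n, x, y, h⟩ := (A.coact τ).exists_rep
    rw [(S.tensorCoact_rep hE m h).map_eq, tensorAct_s,
      ← A.coact_counit _ _ _ (A.coact_unit_mul r h), S.tprod_sum]
    simp only [RightBialgebroid.counitSnd_tmul, tensorRact_tprod]
  | add q q' h h' => simp only [map_add, h, h']
  | zero => simp

/-- The action as a map `x ⊗ y ↦ y ▷ x` on `(M ⊗_K T) ⊗_R B`. -/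
def actSwap : Bal (fun r : R => S.tensorRact hE (op r)) H.tR →ₗ[k] S.tensor E :=
  Bal.lift _ _ (S.tensorAct hE).toLinearMap.flip (fun r x y => by simp [tensorRact_eq])

theorem actSwap_tmul (x : S.tensor E) (y : B) :
    S.actSwap hE (Bal.tmul _ _ x y) = S.tensorAct hE y x :=
  Bal.lift_tmul _ _ _ _ _ _

/-- As τ₀ ⊗ τ₁ = can(1 ⊗ τ), the value on m ⊗ τ is m₀ ⊗ τ (m₋₁ ▷ 1) = m₀ ⊗ τ ε(m₋₁). Moving ε(m₋₁)
across ⊗_K as t(ε(m₋₁)) reduces this to the counit axiom of M. -/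
theorem actSwap_tensorCoact (q : S.tensor E) : S.actSwap hE (S.tensorCoact hE q) = q := by
  induction q using Bal.induction_on with
  | tmul m τ =>
    obtain ⟨n, x, y, h⟩ := (A.coact τ).exists_rep
    obtain ⟨p, u, v, hm⟩ := (S.coact m).exists_rep
    rw [(S.tensorCoact_rep hE m h).map_eq]
    simp only [actSwap_tmul, tensorAct_tprod]
    have e : ∑ i, Bal.tmul _ _ (x i) (y i) = A.can (Bal.tmul _ _ 1 τ) := by
      rw [show A.can _ = _ from A.can_tmul_of_rep 1 h]
      simp only [one_mul]
    rw [← LinearMap.sum_apply, ← map_sum, e, galoisAct_can, S.twist_tmul hE _ _ hm]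
    simp only [hE.act_one, ← hE.act_t, ← S.act_tprod, ← S.lact_eq, ← Bal.sum_tmul]
    rw [S.coact_counit m u v hm]
  | add q q' h h' => simp only [map_add, h, h']
  | zero => simp

/-- The map `x ⊗ y ↦ (b⁺ ▷ x) ⊗ e y b⁻`. -/
abbrev yd (e b : B) : Bal (fun r : R => S.tensorRact hE (op r)) H.tR →ₗ[k]
    Bal (fun r : R => S.tensorRact hE (op r)) H.tR :=
  H.transActSnd (S.tensorRact hE) (S.tensorAct hE) (S.tensorRact_eq hE) e b

theorem yd_add_left (e e' b : B) : S.yd hE (e + e') b = S.yd hE e b + S.yd hE e' b :=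
  Bal.hom_ext fun x y => by simp [H.transActSnd_tmul, add_mul]

theorem yd_smul_left (c : k) (e b : B) : S.yd hE (c • e) b = c • S.yd hE e b :=
  Bal.hom_ext fun x y => by simp [H.transActSnd_tmul]

theorem yd_add_right (e b b' : B) : S.yd hE e (b + b') = S.yd hE e b + S.yd hE e b' :=
  Bal.hom_ext fun x y => by simp [H.transActSnd_tmul]

theorem yd_smul_right (c : k) (e b : B) : S.yd hE e (c • b) = c • S.yd hE e b :=
  Bal.hom_ext fun x y => by simp [H.transActSnd_tmul]

variable (E) in
omit hE in
/-- The linear map `τ ↦ m ⊗ τ`. -/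
def tprodLin (m : M) : T →ₗ[k] S.tensor E :=
  Bal.mk (fun κ : K => S.act (op κ)) (fun κ : K => E.act κ) m

/-- The trilinear map `(τ, z, b) ↦ (b⁺ ▷ (m ⊗ a τ)) ⊗ e z b⁻`. -/
def transTprod (m : M) (a : T) (e : B) : T →ₗ[k] B →ₗ[k] B →ₗ[k]
    Bal (fun r : R => S.tensorRact hE (op r)) H.tR :=
  (H.transAct (S.tensorRact hE) (S.tensorAct hE) (S.tensorRact_eq hE)).compl₁₂
    (S.tprodLin E m ∘ₗ LinearMap.mulLeft k a) (LinearMap.mulLeft k e)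

theorem transTprod_apply (m : M) (a : T) (e : B) (τ : T) (z b : B) :
    S.transTprod hE m a e τ z b = H.transAct (S.tensorRact hE) (S.tensorAct hE)
      (S.tensorRact_eq hE) (S.tprod E m (a * τ)) (e * z) b := rfl

theorem transTprod_ract (m : M) (a : T) (e : B) (r : R) (τ : T) (z b : B) :
    S.transTprod hE m a e (A.ract (op r) τ) z b =
      S.transTprod hE m a e τ (z * H.t (op r)) b := by
  have e₁ : S.tprod E m (a * A.ract (op r) τ) = S.tensorRact hE (op r) (S.tprod E m (a * τ)) := by
    rw [tensorRact_tprod, A.mul_ract]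
  simp only [transTprod_apply, e₁, H.transAct_ract, mul_assoc]

/-- The translation map puts s(r) to the right of b⁺, where it multiplies τ₀ by r; the Takeuchi
property of T converts this into t(r) before τ₁. It makes the anti Yetter-Drinfeld expression well
defined on Δ(b). -/
theorem yd_mul_s (e b : B) (r : R) (q : S.tensor E) :
    S.yd hE e (b * H.s r) (S.tensorCoact hE q) =
      S.yd hE (e * H.t (op r)) b (S.tensorCoact hE q) := by
  induction q using Bal.induction_on with
  | tmul m τ =>
    obtain ⟨n, x, y, h⟩ := (A.coact τ).exists_rep
    rw [(S.tensorCoact_rep hE m h).map_eq, (S.tensorCoact_rep hE m h).map_eq]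
    simp only [H.transActSnd_tmul, H.transAct_mul_s, tensorAct_s, mul_assoc]
    have hf : ∀ x y, (S.transTprod hE m 1 e).compr₂ (LinearMap.applyₗ b) x y =
        H.transAct (S.tensorRact hE) (S.tensorAct hE) (S.tensorRact_eq hE) (S.tprod E m x)
          (e * y) b := fun x y => by
      simp only [LinearMap.compr₂_apply, LinearMap.applyₗ_apply_apply, transTprod_apply, one_mul]
    have := A.sum_takeuchi ((S.transTprod hE m 1 e).compr₂ (LinearMap.applyₗ b))
      (fun r x y => by
        simp only [LinearMap.compr₂_apply, LinearMap.applyₗ_apply_apply, transTprod_ract]) r h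
    simp only [hf] at this
    exact this
  | add q q' h h' => simp only [map_add, h, h']
  | zero => simp

/-- The translation map puts s(r) to the left of b⁻, next to q₁, and q₀ ⊗ q₁s(r) is the coaction of
qr. -/
theorem yd_mul_t (e b : B) (r : R) (q : S.tensor E) :
    S.yd hE e (b * H.t (op r)) (S.tensorCoact hE q) =
      S.yd hE e b (S.tensorCoact hE (S.tensorRact hE (op r) q)) := by
  obtain ⟨n, x, y, h⟩ := (S.tensorCoact hE q).exists_rep
  rw [tensorCoact_ract, h.map_eq, h.map_eq, map_sum]
  simp only [H.mulSSnd_tmul, H.transActSnd_tmul, H.transAct_mul_t, mul_assoc]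

/-- The trilinear map `(q, b, b') ↦ (b⁺ ▷ q₀) ⊗ b' q₁ b⁻`. -/
def ydLin : S.tensor E →ₗ[k] B →ₗ[k] B →ₗ[k]
    Bal (fun r : R => S.tensorRact hE (op r)) H.tR :=
  LinearMap.mk₂ k (fun q b =>
    { toFun := fun e => S.yd hE e b (S.tensorCoact hE q)
      map_add' := fun e e' => by rw [yd_add_left, LinearMap.add_apply]
      map_smul' := fun c e => by rw [yd_smul_left, LinearMap.smul_apply, RingHom.id_apply] })
    (fun q q' b => LinearMap.ext fun e => by
      simp only [LinearMap.coe_mk, AddHom.coe_mk, LinearMap.add_apply, map_add])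
    (fun c q b => LinearMap.ext fun e => by
      simp only [LinearMap.coe_mk, AddHom.coe_mk, LinearMap.smul_apply, map_smul])
    (fun q b b' => LinearMap.ext fun e => by
      simp only [LinearMap.coe_mk, AddHom.coe_mk, LinearMap.add_apply, yd_add_right])
    (fun c q b => LinearMap.ext fun e => by
      simp only [LinearMap.coe_mk, AddHom.coe_mk, LinearMap.smul_apply, yd_smul_right])

theorem ydLin_apply (q : S.tensor E) (b e : B) :
    S.ydLin hE q b e = S.yd hE e b (S.tensorCoact hE q) := rfl

/-- The map `b ⊗ b' ↦ (b⁺ ▷ q₀) ⊗ b' q₁ b⁻`. -/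
def ydCoact (q : S.tensor E) : Bal H.sR H.tR →ₗ[k]
    Bal (fun r : R => S.tensorRact hE (op r)) H.tR :=
  Bal.lift _ _ (S.ydLin hE q) (fun r b e => S.yd_mul_s hE e b r q)

theorem ydCoact_tmul (q : S.tensor E) (b e : B) :
    S.ydCoact hE q (Bal.tmul _ _ b e) = S.ydLin hE q b e :=
  Bal.lift_tmul _ _ _ _ _ _

theorem ydCoact_add (q q' : S.tensor E) :
    S.ydCoact hE (q + q') = S.ydCoact hE q + S.ydCoact hE q' :=
  Bal.hom_ext fun x y => by
    simp only [ydCoact_tmul, map_add, LinearMap.add_apply]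

theorem ydCoact_smul (c : k) (q : S.tensor E) :
    S.ydCoact hE (c • q) = c • S.ydCoact hE q :=
  Bal.hom_ext fun x y => by
    simp only [ydCoact_tmul, map_smul, LinearMap.smul_apply]

/-- The bilinear map `(q, b) ↦ (b⁽¹⁾⁺ ▷ q₀) ⊗ b⁽²⁾ q₁ b⁽¹⁾⁻`. -/
def ydComul : S.tensor E →ₗ[k] B →ₗ[k] Bal (fun r : R => S.tensorRact hE (op r)) H.tR :=
  LinearMap.mk₂ k (fun q b => S.ydCoact hE q (H.comul b))
    (fun q q' b => by rw [ydCoact_add, LinearMap.add_apply])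
    (fun c q b => by rw [ydCoact_smul, LinearMap.smul_apply])
    (fun q b b' => by rw [map_add, map_add])
    (fun c q b => by rw [map_smul, map_smul])

theorem ydComul_of_rep (q : S.tensor E) {b : B} {n : ℕ} {u v : Fin n → B}
    (h : (H.comul b).Rep u v) : S.ydComul hE q b = ∑ i, S.ydLin hE q (u i) (v i) := by
  refine (h.map_eq (S.ydCoact hE q)).trans ?_
  simp only [ydCoact_tmul]

/-- The map `τ ⊗ b ↦ (b⁽¹⁾⁺ ▷ (m ⊗ τ)₀) ⊗ b⁽²⁾ (m ⊗ τ)₁ b⁽¹⁾⁻`. -/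
def ydTensor (m : M) : Bal (fun r : R => A.ract (op r)) H.tR →ₗ[k]
    Bal (fun r : R => S.tensorRact hE (op r)) H.tR :=
  Bal.lift _ _ (S.ydComul hE ∘ₗ S.tprodLin E m)
    (fun r τ b => by
      obtain ⟨n, u, v, h⟩ := (H.comul b).exists_rep
      have h' : (H.comul (b * H.t (op r))).Rep (fun i => u i * H.t (op r)) v := H.comul_t r b u v h
      refine (S.ydComul_of_rep hE _ h).trans ((S.ydComul_of_rep hE _ h').trans ?_).symm
      simp only [ydLin_apply, yd_mul_t]
      exact Finset.sum_congr rfl fun i _ => congrArg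
        (fun q => S.yd hE (v i) (u i) (S.tensorCoact hE q)) (S.tensorRact_tprod hE (op r) m τ))

theorem ydTensor_tmul (m : M) (τ : T) (b : B) :
    S.ydTensor hE m (Bal.tmul _ _ τ b) = S.ydComul hE (S.tprod E m τ) b :=
  Bal.lift_tmul _ _ _ _ _ _

/-- Multiplicativity and K-equivariance of the coaction of T, applied to β (m₋₁ ▷ α). -/
theorem tensorCoact_twist (m : M) {α β : T} {n p : ℕ} {a : Fin n → T} {c : Fin n → B}
    {x : Fin p → T} {y : Fin p → B} (hα : (A.coact α).Rep a c) (hβ : (A.coact β).Rep x y) :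
    S.tensorCoact hE (S.twist hE (Bal.tmul _ _ α β) m) =
      ∑ i, ∑ l, Bal.tmul _ _ (S.twist hE (Bal.tmul _ _ (a l) (x i)) m) (y i * c l) := by
  obtain ⟨q, u, v, hm⟩ := (S.coact m).exists_rep
  simp only [S.twist_tmul hE _ _ hm, map_sum, Bal.sum_tmul]
  have e : ∀ j, S.tensorCoact hE (S.tprod E (v j) (β * E.act (u j) α)) =
      ∑ i, ∑ l, Bal.tmul _ _ (S.tprod E (v j) (x i * E.act (u j) (a l))) (y i * c l) := fun j => by
    rw [tensorCoact_tprod, A.coact_mul _ _ _ _ _ _ hβ (hE.equivariant (u j) α a c hα)]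
    simp only [map_sum, tprodFst_tmul]
  simp only [e]
  rw [Finset.sum_comm]
  exact Finset.sum_congr rfl fun i _ => Finset.sum_comm

/-- By coassociativity the right side is (x₁⁽²⁾⁺ ▷ (m ⊗ α₀x₀)) ⊗ yα₁ x₁⁽¹⁾x₁⁽²⁾⁻, and `sum_transAct`
collapses it to (x₁ ▷ (m ⊗ α₀x₀)) ⊗ yα₁. -/
theorem sum_galoisAct_tmul (m : M) {α x : T} {n p : ℕ} {a : Fin n → T} {c : Fin n → B}
    {u : Fin p → T} {v : Fin p → B} (hα : (A.coact α).Rep a c) (hx : (A.coact x).Rep u v)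
    (y : B) :
    ∑ l, Bal.tmul (fun r : R => S.tensorRact hE (op r)) H.tR
        (S.galoisAct hE (A.can (Bal.tmul _ _ (a l) x)) m) (y * c l) =
      ∑ j, S.yd hE y (v j) (S.tensorCoact hE (S.tprod E m (α * u j))) := by
  have e : ∀ l, S.galoisAct hE (A.can (Bal.tmul _ _ (a l) x)) m =
      ∑ j, S.tensorAct hE (v j) (S.tprod E m (a l * u j)) := fun l => by
    rw [(A.can_tmul_of_rep (a l) hx).map_eq, LinearMap.sum_apply]
    simp only [tensorAct_tprod]
  simp only [e, Bal.sum_tmul]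
  rw [Finset.sum_comm]
  symm
  refine A.sum_eq_of_coassoc (∑ l, S.transTprod hE m (a l) (y * c l))
      (fun r x z w => ?_) (fun r x z w => ?_)
      (fun x z => S.yd hE y z (S.tensorCoact hE (S.tprod E m (α * x))))
      (fun x z => ∑ l, Bal.tmul _ _ (S.tensorAct hE z (S.tprod E m (a l * x))) (y * c l))
      (fun x z n u v h => ?_) (fun x z n u v h => ?_) hx
  · simp only [LinearMap.sum_apply, transTprod_ract]
  · simp only [LinearMap.sum_apply, transTprod_apply, H.transAct_mul_t, mul_assoc]
  · have e₁ := A.coact_mul α x a c u v hα h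
    simp only [LinearMap.sum_apply, transTprod_apply, tensorCoact_tprod, e₁, map_sum,
      tprodFst_tmul, H.transActSnd_tmul, mul_assoc]
    exact Finset.sum_comm
  · simp only [LinearMap.sum_apply, transTprod_apply]
    refine (Finset.sum_congr rfl fun l _ => ?_).trans Finset.sum_comm
    exact (H.sum_transAct _ _ _ _ _ h).symm

/-- The anti Yetter-Drinfeld condition in a form linear in τ ⊗ b, so that it can be tested on αβ₀ ⊗
β₁. Coassociativity of T on β matches the two sides, with `sum_galoisAct_tmul` supplying one of
them. -/
theorem tensorCoact_galoisAct (m : M) (z : Bal (fun r : R => A.ract (op r)) H.tR) :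
    S.tensorCoact hE (S.galoisAct hE z m) = S.ydTensor hE m z := by
  induction z using hE.induction_can with
  | can α β =>
    obtain ⟨n, a, c, hα⟩ := (A.coact α).exists_rep
    obtain ⟨p, x, y, hβ⟩ := (A.coact β).exists_rep
    rw [galoisAct_can, S.tensorCoact_twist hE m hα hβ, (A.can_tmul_of_rep α hβ).map_eq]
    simp only [ydTensor_tmul]
    have hf : ∀ x w y, (S.ydLin hE ∘ₗ S.tprodLin E m ∘ₗ LinearMap.mulLeft k α) x w y =
      S.yd hE y w (S.tensorCoact hE (S.tprod E m (α * x))) := fun _ _ _ => rfl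
    refine A.sum_eq_of_coassoc (S.ydLin hE ∘ₗ S.tprodLin E m ∘ₗ LinearMap.mulLeft k α)
        (fun r x w y => ?_) (fun r x w y => ?_)
        (fun x y => ∑ l, Bal.tmul _ _ (S.twist hE (Bal.tmul _ _ (a l) x) m) (y * c l))
        (fun x y => S.ydComul hE (S.tprod E m (α * x)) y)
        (fun x y n u v h => ?_) (fun x y n u v h => ?_) hβ
    · have e₁ : S.tprod E m (α * A.ract (op r) x) = S.tensorRact hE (op r) (S.tprod E m (α * x)) := by
        rw [tensorRact_tprod, A.mul_ract]
      simp only [hf, e₁, yd_mul_t]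
    · simp only [hf, yd_mul_s]
    · simp only [← galoisAct_can, hf]
      exact S.sum_galoisAct_tmul hE m hα h y
    · exact S.ydComul_of_rep hE _ h
  | add z z' h h' => simp only [map_add, LinearMap.add_apply, h, h']
  | zero => simp

theorem tensorCoact_act (b : B) (q : S.tensor E) {n : ℕ} {b₁ b₂ : Fin n → B}
    (h : (H.comul b).Rep b₁ b₂) :
    S.tensorCoact hE (S.tensorAct hE b q) = ∑ i, S.yd hE (b₂ i) (b₁ i) (S.tensorCoact hE q) := by
  induction q using Bal.induction_on with
  | tmul m τ =>
    change S.tensorCoact hE (S.tensorAct hE b (S.tprod E m τ)) =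
      ∑ i, S.yd hE (b₂ i) (b₁ i) (S.tensorCoact hE (S.tprod E m τ))
    rw [tensorAct_tprod, tensorCoact_galoisAct, ydTensor_tmul, S.ydComul_of_rep hE _ h]
    rfl
  | add q q' h h' => simp only [map_add, h, h', Finset.sum_add_distrib]
  | zero => simp

/-- The left-right SAYD module `M ⊗_K T`. -/
def tensorSAYD : LeftRightSAYD H (S.tensor E) where
  toRightComodule := S.tensorComodule hE
  act := S.tensorAct hE
  ract_eq := S.tensorRact_eq hE
  lact_eq r q n x y h := by
    have e := S.counitSnd_tensorCoact hE r q
    have h' : (S.tensorCoact hE q).Rep x y := h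
    rw [h'.map_eq] at e
    simp only [RightBialgebroid.counitSnd_tmul] at e
    exact e
  ayd b q n p l b₁ b₂ b₁m b₁p x y hb hb₁ h := by
    have h' : (S.tensorCoact hE q).Rep x y := h
    refine (S.tensorCoact_act hE b q hb).trans (Finset.sum_congr rfl fun i _ => ?_)
    refine (h'.map_eq _).trans (Eq.trans ?_ Finset.sum_comm)
    refine Finset.sum_congr rfl fun j _ => ?_
    exact (H.transActSnd_tmul _ _ _ _ _ _ _).trans (H.transAct_of_rep _ _ _ _ _ (hb₁ i))
  stable q n x y h := by
    have e := S.actSwap_tensorCoact hE q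
    have h' : (S.tensorCoact hE q).Rep x y := h
    rw [h'.map_eq] at e
    simp only [actSwap_tmul] at e
    exact e

end RightLeftSAYD

/-! ### Functoriality in M -/

namespace RightLeftSAYDCat

variable (hE : IsEquivariantGalois A E)
include hE

/-- `M ⊗_K T` as an object of the category of left-right SAYD modules. -/
abbrev tensorObj (M : RightLeftSAYDCat.{uk, uT, uK, w} L) :
    LeftRightSAYDCat.{uk, uR, uB, max w uT} H :=
  ⟨tensorOver M E, M.str.tensorSAYD hE⟩

omit hE in
/-- `φ ⊗ id`. -/
def tensorLin {M N : RightLeftSAYDCat.{uk, uT, uK, w} L} (φ : M ⟶ N) :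
    M.str.tensor E →ₗ[k] N.str.tensor E :=
  Bal.map φ.toLin LinearMap.id (fun κ m τ => by
    have := N.str.act_tprod (E := E) κ (φ.toLin m) τ
    rwa [← φ.map_act] at this)

omit hE in
theorem tensorLin_tprod {M N : RightLeftSAYDCat.{uk, uT, uK, w} L} (φ : M ⟶ N) (m : M.carrier)
    (τ : T) : tensorLin φ (M.str.tprod E m τ) = N.str.tprod E (φ.toLin m) τ :=
  Bal.map_tmul _ _ _ _ _

theorem tensorLin_act {M N : RightLeftSAYDCat.{uk, uT, uK, w} L} (φ : M ⟶ N) (b : B)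
    (q : M.str.tensor E) :
    tensorLin φ (M.str.tensorAct hE b q) = N.str.tensorAct hE b (tensorLin φ q) := by
  induction q using Bal.induction_on with
  | tmul m τ =>
    obtain ⟨n, x, y, h⟩ := (M.str.coact m).exists_rep
    obtain ⟨p, u, v, hb⟩ := (hE.canInv b).exists_rep
    -- Colinearity lets the same m₋₁ serve for φ(m), so the explicit action formulas agree term by
    -- term.
    have h' : (N.str.coact (φ.toLin m)).Rep x (fun i => φ.toLin (y i)) := φ.map_coact m x y h
    rw [RightLeftSAYD.tensorAct_apply, RightLeftSAYD.tensorAct_apply, tensorLin_tprod,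
      M.str.actLin_tprod_of_rep hE b m τ h hb, N.str.actLin_tprod_of_rep hE b _ τ h' hb]
    simp only [map_sum, tensorLin_tprod]
  | add q q' h h' => simp only [map_add, h, h']
  | zero => simp

/-- `φ ⊗ id` on `(M ⊗_K T) ⊗_R B`. -/
def tensorLinFst {M N : RightLeftSAYDCat.{uk, uT, uK, w} L} (φ : M ⟶ N) :
    Bal (fun r : R => M.str.tensorRact hE (op r)) H.tR →ₗ[k]
      Bal (fun r : R => N.str.tensorRact hE (op r)) H.tR :=
  Bal.map (tensorLin φ) LinearMap.id (fun r q b => by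
    have := Bal.tmul_balanced (fun r : R => N.str.tensorRact hE (op r)) H.tR r (tensorLin φ q) b
    -- Right R-linearity is a case of B-linearity, because r acts as t(r).
    rwa [RightLeftSAYD.tensorRact_eq, ← tensorLin_act, ← RightLeftSAYD.tensorRact_eq] at this)

theorem tensorLinFst_tmul {M N : RightLeftSAYDCat.{uk, uT, uK, w} L} (φ : M ⟶ N)
    (q : M.str.tensor E) (b : B) :
    tensorLinFst hE φ (Bal.tmul _ _ q b) = Bal.tmul _ _ (tensorLin φ q) b :=
  Bal.map_tmul _ _ _ _ _

theorem tensorCoact_tensorLin {M N : RightLeftSAYDCat.{uk, uT, uK, w} L} (φ : M ⟶ N)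
    (q : M.str.tensor E) :
    N.str.tensorCoact hE (tensorLin φ q) = tensorLinFst hE φ (M.str.tensorCoact hE q) := by
  induction q using Bal.induction_on with
  | tmul m τ =>
    obtain ⟨n, x, y, h⟩ := (A.coact τ).exists_rep
    rw [tensorLin_tprod, (M.str.tensorCoact_rep hE m h).map_eq,
      show N.str.tensorCoact hE _ = _ from N.str.tensorCoact_rep hE (φ.toLin m) h]
    simp only [tensorLinFst_tmul, tensorLin_tprod]
  | add q q' h h' => simp only [map_add, h, h']
  | zero => simp

/-- `φ ⊗ id` as a morphism. -/
def tensorMap {M N : RightLeftSAYDCat.{uk, uT, uK, w} L} (φ : M ⟶ N) :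
    tensorObj hE M ⟶ tensorObj hE N where
  toLin := tensorLin φ
  map_act b q := tensorLin_act hE φ b q
  map_coact q n x y h := by
    have h' : (M.str.tensorCoact hE q).Rep x y := h
    exact (tensorCoact_tensorLin hE φ q).trans ((h'.map_eq _).trans
      (Finset.sum_congr rfl fun i _ => tensorLinFst_tmul hE φ (x i) (y i)))

/-- The functor `M ↦ M ⊗_K T`. -/
def tensorFunctor :
    RightLeftSAYDCat.{uk, uT, uK, w} L ⥤ LeftRightSAYDCat.{uk, uR, uB, max w uT} H where
  obj M := tensorObj hE M
  map φ := tensorMap hE φ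
  map_id M := LeftRightSAYDCat.Hom.ext (Bal.hom_ext fun m τ => tensorLin_tprod _ m τ)
  map_comp {M N P} φ ψ := LeftRightSAYDCat.Hom.ext (Bal.hom_ext fun m τ => by
    refine (tensorLin_tprod _ m τ).trans ?_
    refine Eq.trans ?_ (congrArg (tensorLin (E := E) ψ) (tensorLin_tprod φ m τ)).symm
    exact (tensorLin_tprod ψ _ τ).symm)

end RightLeftSAYDCat

end Galois

end

/-! ### The proposition -/

theorem proposition3p4 {k : Type uk} [CommRing k] {R : Type uR} [Ring R] [Algebra k R]
    {B : Type uB} [Ring B] [Algebra k B] {K : Type uK} [Ring K] [Algebra k K]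
    {T : Type uT} [Ring T] [Algebra k T]
    (H : RightTimesHopf k R B) (A : ComoduleAlgebra H.toRightBialgebroid T)
    (L : LeftTimesHopf k A.coinvariants K) (E : ModuleAlgebra L.toLeftBialgebroid T)
    (hE : IsEquivariantGalois A E) :
    ∃ (str : ∀ M : RightLeftSAYDCat.{uk, uT, uK, w} L, LeftRightSAYD H (tensorOver M E))
      (map : ∀ {M N : RightLeftSAYDCat.{uk, uT, uK, w} L}, (M ⟶ N) →
        ((⟨tensorOver M E, str M⟩ : LeftRightSAYDCat.{uk, uR, uB, max w uT} H) ⟶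
          ⟨tensorOver N E, str N⟩)),
      -- the action of `B`: `b ▷ (m ⊗ τ) = m₀ ⊗ b⁽⁺⁾ (m₋₁ ▷ (τ b⁽⁻⁾))`
      (∀ (M : RightLeftSAYDCat.{uk, uT, uK, w} L) (b : B) (m : M.carrier) (τ : T) {n p : ℕ}
        (x : Fin n → K) (y : Fin n → M.carrier) (u v : Fin p → T),
        (M.str.coact m).Rep x y → (hE.canInv b).Rep u v →
        (str M).act b (Bal.tmul _ _ m τ) =
          ∑ i, ∑ j, Bal.tmul _ _ (y i) (v j * E.act (x i) (τ * u j))) ∧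
      -- the right action of `R` and the coaction of `B`: `m ⊗ τ ↦ (m ⊗ τ₀) ⊗ τ₁`
      (∀ (M : RightLeftSAYDCat.{uk, uT, uK, w} L) (r : R) (m : M.carrier) (τ : T),
        (str M).ract (op r) (Bal.tmul _ _ m τ) = Bal.tmul _ _ m (A.ract (op r) τ)) ∧
      (∀ (M : RightLeftSAYDCat.{uk, uT, uK, w} L) (m : M.carrier) (τ : T) {n : ℕ}
        (x : Fin n → T) (y : Fin n → B), (A.coact τ).Rep x y →
        (str M).coact (Bal.tmul _ _ m τ) = ∑ i, Bal.tmul _ _ (Bal.tmul _ _ m (x i)) (y i)) ∧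
      -- on morphisms the functor is `φ ⊗ Id`
      (∀ {M N : RightLeftSAYDCat.{uk, uT, uK, w} L} (φ : M ⟶ N) (m : M.carrier) (τ : T),
        (map φ).toLin (Bal.tmul _ _ m τ) = Bal.tmul _ _ (φ.toLin m) τ) ∧
      ∃ F : RightLeftSAYDCat.{uk, uT, uK, w} L ⥤ LeftRightSAYDCat.{uk, uR, uB, max w uT} H,
        F.toPrefunctor = { obj := fun M => ⟨tensorOver M E, str M⟩, map := fun φ => map φ } := by
  refine ⟨fun M => M.str.tensorSAYD hE, fun φ => RightLeftSAYDCat.tensorMap hE φ, ?_, ?_, ?_, ?_,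
    RightLeftSAYDCat.tensorFunctor hE, rfl⟩
  · intro M b m τ n p x y u v hm hb
    exact M.str.actLin_tprod_of_rep hE b m τ hm hb
  · intro M r m τ
    exact M.str.tensorRact_tprod hE (op r) m τ
  · intro M m τ n x y h
    exact M.str.tensorCoact_rep hE m h
  · intro M N φ m τ
    exact RightLeftSAYDCat.tensorLin_tprod φ m τ
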